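/- **Conventions.** A topological groupoid is a groupoid $G$ (identified with its set of arrows, with unit space $G^0\subset G$, domain and range maps $d,r\colon G\to G^0$) equipped with a topology for which multiplication (on composable pairs $(x,y)$, $d(x)=r(y)$) and inversion are continuous; $G^u=r^{-1}(u)$ for $u\in G^0$. For a topological space $Y$, $C_c(Y)$ denotes the linear span, in the space of all functions $Y\to\mathbb{C}$, of those functions $f$ for which there is a Hausdorff open set $U\subset Y$ such that $f$ vanishes outside $U$ and $f|_U$ is continuous with compact support. A (possibly non-Hausdorff) locally compact groupoid is a topological groupoid $G$ such that $G^0$ and all $G^u$ are locally compact Hausdorff, and there is a countable family of compact Hausdorff subsets of $G$ whose interiors form a basis of the topology of $G$. A Haar system on $G$ is a family $\lambda=\{\lambda^u\}_{u\in G^0}$ of positive regular Borel measures $\lambda^u$ on $G^u$ with full support such that for all $f\in C_c(G)$ the function $u\mapsto\int_{G^u} f\,d\lambda^u$ belongs to $C_c(G^0)$, and $\int_{G^{d(x)}}f(xz)\,d\lambda^{d(x)}(z)=\int_{G^{r(x)}}f(y)\,d\lambda^{r(x)}(y)$ for all $x\in G$. Then $C_c(G)$ is a $*$-algebra under $$(f*g)(x)=\int_{G^{r(x)}}f(y)g(y^{-1}x)\,d\lambda^{r(x)}(y),\qquad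 f^*(x)=\overline{f(x^{-1})},$$ and the maximal groupoid $C^*$-algebra $C^*(G)=C^*(G,\lambda)$ is its $C^*$-envelope: the completion of $C_c(G)$ in the seminorm $f\mapsto\sup_\rho\|\rho(f)\|$, where $\rho$ runs over the $*$-representations of $C_c(G)$ on Hilbert spaces that satisfy $\|\rho(f)\|\le\|f\|_I$ for all $f$, with $\|f\|_I=\max\left(\sup_{u}\int_{G^u}|f(x)|\,d\lambda^u(x),\ \sup_u\int_{G^u}|f(x^{-1})|\,d\lambda^u(x)\right)$. A map $\pi\colon G\to H$ between topological groupoids is a fiberwise groupoid covering if it is a surjective groupoid homomorphism and a local homeomorphism, and restricts to a homeomorphism $G^0\to H^0$. If $G$ and $H$ are locally compact groupoids with Haar systems $\lambda_G$ and $\lambda_H$, then $\pi$ intertwines the Haar systems if for all $u\in G^0$ and all open $U\subset G$ for which $\pi|_U$ is a homeomorphism onto its image, the push-forward of $\lambda_G^u|_{U\cap G^u}$ under $\pi|_{U\cap G^u}$ is $\lambda_H^{\pi(u)}|_{\pi(U)\cap H^{\pi(u)}}$. **Theorem.** Let $G$ and $H$ be locally compact groupoids with Haar systems $\lambda_G$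 and $\lambda_H$, and let $\pi\colon G\to H$ be a fiberwise groupoid covering that intertwines $\lambda_G$ and $\lambda_H$. Then for all $f\in C_c(G)$ and $y\in H$ only finitely many $x\in\pi^{-1}(y)$ satisfy $f(x)\neq 0$, and the formula $$\pi_*(f)(y)=\sum_{x\in\pi^{-1}(y)}f(x)\qquad(f\in C_c(G),\ y\in H)$$ defines a surjective $*$-homomorphism $\pi_*\colon C_c(G)\to C_c(H)$ of convolution $*$-algebras. Consequently $C^*(H)$ is a quotient of $C^*(G)$: there is a surjective $*$-homomorphism $C^*(G)\to C^*(H)$ that is compatible with $\pi_*$ under the canonical maps $C_c(G)\to C^*(G)$ and $C_c(H)\to C^*(H)$. -/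

import Mathlib

namespace FiberwiseCovering

open MeasureTheory Filter Topology
open scoped ENNReal

/-- A topological groupoid, presented by its space of arrows `G`, with domain map `d`, range map `r`,
multiplication and inversion. The product `mul x y` is only meaningful if `(x, y)` is composable,
i.e. `d x = r y`; the values of `mul` at other pairs are irrelevant, and no axiom mentions them. -/
class TopGroupoid (G : Type*) [TopologicalSpace G] where
  d : G → G
  r : G → G
  mul : G → G → G
  inv : G → G
  r_d : ∀ x, r (d x) = d x
  d_r : ∀ x, d (r x) = r x
  d_mul : ∀ x y, d x = r y → d (mul x y) = d y
  r_mul : ∀ x y, d x = r y → r (mul x y) = r x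
  assoc : ∀ x y z, d x = r y → d y = r z → mul (mul x y) z = mul x (mul y z)
  id_mul : ∀ x, mul (r x) x = x
  mul_id : ∀ x, mul x (d x) = x
  d_inv : ∀ x, d (inv x) = r x
  r_inv : ∀ x, r (inv x) = d x
  mul_inv_self : ∀ x, mul x (inv x) = r x
  inv_mul_self : ∀ x, mul (inv x) x = d x
  continuousOn_mul : ContinuousOn (fun p : G × G => mul p.1 p.2) {p | d p.1 = r p.2}
  cont_inv : Continuous inv

open TopGroupoid

/-- The unit space `G⁰`. -/
def units (G : Type*) [TopologicalSpace G] [TopGroupoid G] : Set G := Set.range (r : G → G)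

/-- The range fiber `Gᵘ = r⁻¹(u)`. (It is empty if `u` is not a unit.) -/
abbrev Fiber {G : Type*} [TopologicalSpace G] [TopGroupoid G] (u : G) : Type _ :=
  {x : G // r x = u}

/-- `f` vanishes outside the Hausdorff open set `U`, and `f|_U` is continuous with compact
support: there is a compact subset of `U` outside of which `f` vanishes. -/
structure IsCcOn {Y : Type*} [TopologicalSpace Y] (U : Set Y) (f : Y → ℂ) : Prop where
  isOpen : IsOpen U
  t2 : T2Space U
  cont : ContinuousOn f U
  supp : ∃ K ⊆ U, IsCompact K ∧ ∀ y ∉ K, f y = 0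

/-- `C_c(Y)`: the linear span, in the space of all complex functions on `Y`, of the set `C_c(Y)₀` of
functions that are, for some Hausdorff open `U ⊆ Y`, zero off `U` and continuous and compactly
supported on `U`. -/
def Cc (Y : Type*) [TopologicalSpace Y] : Submodule ℂ (Y → ℂ) :=
  Submodule.span ℂ {f | ∃ U, IsCcOn U f}

/-- The topological axioms of a (possibly non-Hausdorff) locally compact groupoid. -/
class LCGroupoid (G : Type*) [TopologicalSpace G] [TopGroupoid G] : Prop where
  t2_units : T2Space (units G)
  lc_units : LocallyCompactSpace (units G)
  exists_basis : ∃ 𝒞 : Set (Set G), 𝒞.Countable ∧ (∀ C ∈ 𝒞, IsCompact C ∧ T2Space C) ∧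
    TopologicalSpace.IsTopologicalBasis (interior '' 𝒞)
  t2_fiber : ∀ u ∈ units G, T2Space (Fiber u)
  lc_fiber : ∀ u ∈ units G, LocallyCompactSpace (Fiber u)

/-- A (left) Haar system `{λᵘ}`, `u ∈ G⁰`. (If `u` is not a unit then `Gᵘ` is empty and `λᵘ`
carries no information.) -/
structure HaarSystem (G : Type*) [TopologicalSpace G] [TopGroupoid G] [MeasurableSpace G] where
  meas : ∀ u : G, Measure (Fiber u)
  regular : ∀ u ∈ units G, (meas u).Regular
  full_support : ∀ u ∈ units G, (meas u).IsOpenPosMeasure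
  continuous_integral : ∀ f ∈ Cc G, (fun u : units G => ∫ y : Fiber u.1, f y ∂meas u.1) ∈ Cc (units G)
  invariant : ∀ (x : G), ∀ f ∈ Cc G,
    ∫ z : Fiber (d x), f (mul x z) ∂meas (d x) = ∫ y : Fiber (r x), f y ∂meas (r x)

section Topology

variable {G : Type*} [TopologicalSpace G] [TopGroupoid G]

theorem r_r (x : G) : r (r x) = r x := by
  have h := r_d (r x); rwa [d_r] at h

theorem d_d (x : G) : d (d x) = d x := by
  have h := d_r (d x); rwa [r_d] at h

theorem r_mem (x : G) : r x ∈ units G := ⟨x, rfl⟩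

theorem d_mem (x : G) : d x ∈ units G := ⟨d x, r_d x⟩

theorem inv_inv (x : G) : inv (inv x) = x := by
  have h1 : mul (mul x (inv x)) (inv (inv x)) = x := by
    rw [assoc _ _ _ (by rw [r_inv]) (by rw [r_inv]), mul_inv_self, r_inv, mul_id]
  have h2 : r x = r (inv (inv x)) := by rw [r_inv, d_inv]
  rw [mul_inv_self, h2, id_mul] at h1
  exact h1

theorem inv_mul_cancel_left (x y : G) (h : d x = r y) : mul (inv x) (mul x y) = y := by
  rw [← assoc _ _ _ (d_inv x) h, inv_mul_self, h, id_mul]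

theorem mul_inv_cancel_left (x y : G) (h : r x = r y) : mul x (mul (inv x) y) = y := by
  rw [← assoc _ _ _ (r_inv x).symm (by rw [d_inv, h]), mul_inv_self, h, id_mul]

theorem inv_mul_rev (x y : G) (h : d x = r y) : inv (mul x y) = mul (inv y) (inv x) := by
  have hc : d (inv y) = r (inv x) := by rw [d_inv, r_inv, h]
  have e : mul (mul x y) (mul (inv y) (inv x)) = r x := by
    rw [assoc _ _ _ h (by rw [r_mul _ _ hc, r_inv]), mul_inv_cancel_left _ _ (by rw [r_inv, h]),
      mul_inv_self]
  have := inv_mul_cancel_left (mul x y) (mul (inv y) (inv x))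
    (by rw [d_mul _ _ h, r_mul _ _ hc, r_inv])
  rw [e] at this
  rw [← this]
  have h3 : r x = d (inv (mul x y)) := by rw [d_inv, r_mul _ _ h]
  rw [h3, mul_id]

theorem inv_inv_mul (x y : G) (h : r x = r y) : inv (mul (inv x) y) = mul (inv y) x := by
  rw [inv_mul_rev _ _ (by rw [d_inv, h]), inv_inv]

theorem continuous_r : Continuous (r : G → G) := by
  have : (r : G → G) = fun x => (fun p : G × G => mul p.1 p.2) (x, inv x) := by
    ext x; simp [mul_inv_self]
  rw [this]
  exact continuousOn_mul.comp_continuous (continuous_id.prodMk cont_inv)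
    (fun x => by simp [r_inv])

theorem continuous_d : Continuous (d : G → G) := by
  have : (d : G → G) = fun x => r (inv x) := by ext x; simp [r_inv]
  rw [this]; exact continuous_r.comp cont_inv

theorem tendsto_mul {α : Type*} {F : Filter α} {f g : α → G} {x y : G}
    (hf : Tendsto f F (𝓝 x)) (hg : Tendsto g F (𝓝 y)) (hxy : d x = r y)
    (h : ∀ᶠ a in F, d (f a) = r (g a)) : Tendsto (fun a => mul (f a) (g a)) F (𝓝 (mul x y)) := by
  have h1 := continuousOn_mul (x, y) hxy
  have h2 : Tendsto (fun a => (f a, g a)) F (𝓝[{p : G × G | d p.1 = r p.2}] (x, y)) :=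
    tendsto_nhdsWithin_iff.2 ⟨hf.prodMk_nhds hg, h⟩
  exact h1.tendsto.comp h2

theorem tendsto_inv {α : Type*} {F : Filter α} {f : α → G} {x : G}
    (hf : Tendsto f F (𝓝 x)) : Tendsto (fun a => inv (f a)) F (𝓝 (inv x)) :=
  (cont_inv.tendsto x).comp hf

variable [LCGroupoid G]

/-- Limits in the unit space are unique. -/
theorem units_unique {α : Type*} {F : Filter α} [F.NeBot] {f : α → G} {u v : G}
    (hu : u ∈ units G) (hv : v ∈ units G) (hf : ∀ a, f a ∈ units G)
    (h1 : Tendsto f F (𝓝 u)) (h2 : Tendsto f F (𝓝 v)) : u = v := by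
  have := LCGroupoid.t2_units (G := G)
  have a1 : Tendsto (fun a => (⟨f a, hf a⟩ : units G)) F (𝓝 ⟨u, hu⟩) := tendsto_subtype_rng.2 h1
  have a2 : Tendsto (fun a => (⟨f a, hf a⟩ : units G)) F (𝓝 ⟨v, hv⟩) := tendsto_subtype_rng.2 h2
  exact congrArg Subtype.val (tendsto_nhds_unique a1 a2)

theorem t2_fiber (u : G) : T2Space (Fiber u) := by
  by_cases h : u ∈ units G
  · exact LCGroupoid.t2_fiber u h
  · have : IsEmpty (Fiber u) := ⟨fun x => h ⟨x.1, x.2⟩⟩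
    infer_instance

theorem lc_fiber (u : G) : LocallyCompactSpace (Fiber u) := by
  by_cases h : u ∈ units G
  · exact LCGroupoid.lc_fiber u h
  · have : IsEmpty (Fiber u) := ⟨fun x => h ⟨x.1, x.2⟩⟩
    infer_instance

attribute [local instance] t2_fiber lc_fiber

theorem isClosed_eq_units {X : Type*} [TopologicalSpace X] {a b : X → G} (ha : Continuous a)
    (hb : Continuous b) (ha' : ∀ x, a x ∈ units G) (hb' : ∀ x, b x ∈ units G) :
    IsClosed {x | a x = b x} := by
  have := LCGroupoid.t2_units (G := G)
  have : IsClosed {x | (⟨a x, ha' x⟩ : units G) = ⟨b x, hb' x⟩} :=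
    isClosed_eq (ha.subtype_mk _) (hb.subtype_mk _)
  simpa using this

theorem isClosed_fiber (u : G) : IsClosed {x : G | r x = u} := by
  by_cases h : u ∈ units G
  · exact isClosed_eq_units continuous_r continuous_const r_mem (fun _ => h)
  · have : {x : G | r x = u} = ∅ := Set.eq_empty_of_forall_notMem fun x hx => h ⟨x, hx⟩
    rw [this]; exact isClosed_empty

theorem isClosed_comp : IsClosed {p : G × G | d p.1 = r p.2} :=
  isClosed_eq_units (continuous_d.comp continuous_fst) (continuous_r.comp continuous_snd)
    (fun _ => d_mem _) (fun _ => r_mem _)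

/-- The product of two compact sets is compact. -/
theorem isCompact_mul {K L : Set G} (hK : IsCompact K) (hL : IsCompact L) :
    IsCompact ((fun p : G × G => mul p.1 p.2) '' (K ×ˢ L ∩ {p | d p.1 = r p.2})) :=
  ((hK.prod hL).inter_right isClosed_comp).image_of_continuousOn
    (continuousOn_mul.mono Set.inter_subset_right)

theorem isCompact_fiber {K : Set G} (hK : IsCompact K) (u : G) :
    IsCompact (Subtype.val ⁻¹' K : Set (Fiber u)) := by
  have : IsClosedEmbedding (Subtype.val : Fiber u → G) :=
    (isClosed_fiber u).isClosedEmbedding_subtypeVal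
  exact this.isCompact_preimage hK

variable (G) in
theorem secondCountable : SecondCountableTopology G := by
  obtain ⟨C, hc, -, hb⟩ := LCGroupoid.exists_basis (G := G)
  exact hb.secondCountableTopology (hc.image _)

/-- Every point has a Hausdorff open neighbourhood. -/
theorem exists_t2_nhd (x : G) : ∃ U : Set G, IsOpen U ∧ T2Space U ∧ x ∈ U := by
  obtain ⟨C, hc, hC, hb⟩ := LCGroupoid.exists_basis (G := G)
  obtain ⟨_, ⟨K, hK, rfl⟩, hx, -⟩ := hb.exists_subset_of_mem_open (Set.mem_univ x) isOpen_univ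
  have := (hC K hK).2
  exact ⟨interior K, isOpen_interior,
    (Topology.IsEmbedding.inclusion interior_subset).t2Space, hx⟩

variable (G) in
theorem locallyCompact : LocallyCompactSpace G := by
  refine ⟨fun x n hn => ?_⟩
  obtain ⟨C, hc, hC, hb⟩ := LCGroupoid.exists_basis (G := G)
  obtain ⟨_, ⟨K, hK, rfl⟩, hx, -⟩ := hb.exists_subset_of_mem_open (Set.mem_univ x) isOpen_univ
  have := (hC K hK).2
  have : CompactSpace K := isCompact_iff_compactSpace.1 (hC K hK).1
  have hx' : x ∈ K := interior_subset hx
  obtain ⟨s, hs, hsn, hsc⟩ := LocallyCompactSpace.local_compact_nhds (⟨x, hx'⟩ : K)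
    (Subtype.val ⁻¹' n) (continuous_subtype_val.continuousAt.preimage_mem_nhds hn)
  refine ⟨Subtype.val '' s, ?_, by simpa using hsn, hsc.image continuous_subtype_val⟩
  have := IsInducing.subtypeVal.nhds_eq_comap (⟨x, hx'⟩ : K)
  have h2 : Subtype.val '' s ∈ 𝓝[K] x := by
    rw [nhdsWithin_eq_map_subtype_coe hx']
    exact image_mem_map hs
  rwa [nhdsWithin_eq_nhds.2 (mem_interior_iff_mem_nhds.1 hx)] at h2

end Topology

section CcBasic

variable {Y : Type*} [TopologicalSpace Y]

theorem IsCcOn.mem_Cc {U : Set Y} {f : Y → ℂ} (h : IsCcOn U f) : f ∈ Cc Y :=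
  Submodule.subset_span ⟨U, h⟩

theorem tendsto_of_ultra {X : Type*} {l : Filter X} {V L : Set Y} {f : Y → ℂ} (hV : IsOpen V)
    (hc : ContinuousOn f V) (hLV : L ⊆ V) (hL : IsCompact L) (h0 : ∀ y ∉ L, f y = 0)
    {m : X → Y} {q : Y} (hm : Tendsto m l (𝓝 q))
    (H : ∀ F : Ultrafilter X, ↑F ≤ l → ∀ ℓ ∈ L, Tendsto m F (𝓝 ℓ) → ℓ = q) :
    Tendsto (fun x => f (m x)) l (𝓝 (f q)) := by
  rw [tendsto_iff_ultrafilter]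
  intro F hF
  by_cases hq : q ∈ V
  · exact ((hc.continuousAt (hV.mem_nhds hq)).tendsto.comp hm).mono_left hF
  · rw [h0 q (fun h => hq (hLV h))]
    rcases F.eventually_or.1 (Eventually.of_forall (f := (F : Filter X))
      fun x => Classical.em (m x ∈ L)) with h | h
    · obtain ⟨ℓ, hℓ, hle⟩ := hL.ultrafilter_le_nhds (F.map m) (le_principal_iff.2 h)
      exact absurd (H F hF ℓ hℓ hle ▸ hLV hℓ) hq
    · refine Tendsto.congr' ?_ tendsto_const_nhds
      filter_upwards [h] with x hx using (h0 _ hx).symm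

theorem Cc.tendsto {X : Type*} {l : Filter X} {f : Y → ℂ} (hf : f ∈ Cc Y)
    {m : X → Y} {q : Y} (hm : Tendsto m l (𝓝 q))
    (H : ∀ F : Ultrafilter X, ↑F ≤ l → ∀ ℓ, Tendsto m F (𝓝 ℓ) → ℓ = q) :
    Tendsto (fun x => f (m x)) l (𝓝 (f q)) := by
  induction hf using Submodule.span_induction with
  | mem f h =>
    obtain ⟨U, h⟩ := h
    obtain ⟨L, hLU, hL, h0⟩ := h.supp
    exact tendsto_of_ultra h.isOpen h.cont hLU hL h0 hm (fun F hF ℓ _ => H F hF ℓ)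
  | zero => exact tendsto_const_nhds
  | add f g _ _ hf hg => exact hf.add hg
  | smul c f _ hf => exact hf.const_smul c

theorem Cc.exists_compact {f : Y → ℂ} (hf : f ∈ Cc Y) :
    ∃ K : Set Y, IsCompact K ∧ ∀ y ∉ K, f y = 0 := by
  induction hf using Submodule.span_induction with
  | mem f h => obtain ⟨U, h⟩ := h; obtain ⟨L, -, hL, h0⟩ := h.supp; exact ⟨L, hL, h0⟩
  | zero => exact ⟨∅, isCompact_empty, fun _ _ => rfl⟩
  | add f g _ _ hf hg =>
    obtain ⟨K, hK, h1⟩ := hf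
    obtain ⟨L, hL, h2⟩ := hg
    refine ⟨K ∪ L, hK.union hL, fun y hy => ?_⟩
    rw [Set.mem_union, not_or] at hy
    simp [h1 y hy.1, h2 y hy.2]
  | smul c f _ hf =>
    obtain ⟨K, hK, h1⟩ := hf
    exact ⟨K, hK, fun y hy => by simp [h1 y hy]⟩

theorem Cc.continuous [T2Space Y] {f : Y → ℂ} (hf : f ∈ Cc Y) : Continuous f :=
  continuous_iff_continuousAt.2 fun _ => Cc.tendsto hf tendsto_id
    fun _ hF _ h => tendsto_nhds_unique h (tendsto_id.mono_left hF)

/-- Extension by zero of a continuous compactly supported function on a Hausdorff open subset. -/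
theorem isCcOn_extend {U O : Set Y} (hU : IsOpen U) (hO : IsOpen O) (hT : T2Space U)
    (g : U → ℂ) (hg : Continuous g) (S : Set U) (hS : IsCompact S) (h0 : ∀ y ∉ S, g y = 0)
    (hSO : S ⊆ Subtype.val ⁻¹' O) :
    IsCcOn (U ∩ O) (fun y => by classical exact if h : y ∈ U then g ⟨y, h⟩ else 0) := by
  classical
  refine ⟨hU.inter hO, (Topology.IsEmbedding.inclusion Set.inter_subset_left).t2Space, ?_,
    Subtype.val '' S, ?_, hS.image continuous_subtype_val, ?_⟩
  · refine ContinuousOn.mono ?_ Set.inter_subset_left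
    rw [continuousOn_iff_continuous_domRestrict]
    refine hg.congr fun x => ?_
    simp
  · rintro _ ⟨y, hy, rfl⟩
    exact ⟨y.2, hSO hy⟩
  · intro y hy
    by_cases h : y ∈ U
    · simp only [h, dite_true]
      exact h0 _ fun hh => hy ⟨_, hh, rfl⟩
    · simp [h]

theorem preimage_compact {U K : Set Y} (hK : IsCompact K) (h : K ⊆ U) :
    IsCompact (Subtype.val ⁻¹' K : Set U) := by
  rw [Topology.IsInducing.subtypeVal.isCompact_iff, Subtype.image_preimage_coe,
    Set.inter_eq_self_of_subset_right h]
  exact hK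

/-- Partition of unity: functions in `C_c(Y)₀` can be cut into pieces subordinate to an open cover. -/
theorem IsCcOn.decompose [LocallyCompactSpace Y] {U : Set Y} {f : Y → ℂ} (h : IsCcOn U f)
    (O : Y → Set Y) (hO : ∀ y, IsOpen (O y)) (hmem : ∀ y, y ∈ O y) :
    ∃ (n : ℕ) (c : Fin n → Y) (fs : Fin n → Y → ℂ), (∀ i, IsCcOn (U ∩ O (c i)) (fs i)) ∧
      f = ∑ i, fs i := by
  classical
  obtain ⟨K, hKU, hK, h0⟩ := h.supp
  have := h.t2
  have := h.isOpen.locallyCompactSpace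
  obtain ⟨t, ht⟩ := hK.elim_finite_subcover O hO (fun y _ => Set.mem_iUnion.2 ⟨y, hmem y⟩)
  let c : Fin t.card → Y := fun i => (t.equivFin.symm i).1
  have hK' : IsCompact (Subtype.val ⁻¹' K : Set U) := preimage_compact hK hKU
  obtain ⟨p, hp1, hp2, -, hp4⟩ := exists_continuous_sum_one_of_isOpen_isCompact
    (s := fun i => (Subtype.val ⁻¹' (O (c i)) : Set U))
    (fun i => (hO _).preimage continuous_subtype_val) hK' (by
      intro y hy
      obtain ⟨z, hz, hyz⟩ := Set.mem_iUnion₂.1 (ht hy)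
      refine Set.mem_iUnion.2 ⟨t.equivFin ⟨z, hz⟩, ?_⟩
      simpa [c] using hyz)
  have hfc : Continuous (fun y : U => f y) := continuousOn_iff_continuous_domRestrict.1 h.cont
  refine ⟨t.card, c, _, fun i => isCcOn_extend h.isOpen (hO (c i)) h.t2
    (fun y => (p i y : ℂ) * f y)
    ((Complex.continuous_ofReal.comp (p i).continuous).mul hfc) (tsupport (p i)) (hp4 i)
    (fun y hy => by simp [image_eq_zero_of_notMem_tsupport hy]) (hp1 i), ?_⟩
  funext y
  rw [Finset.sum_apply]
  by_cases hy : y ∈ U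
  · simp only [hy, dite_true]
    rw [← Finset.sum_mul]
    by_cases hyK : y ∈ K
    · have := hp2 (x := ⟨y, hy⟩) hyK
      rw [Finset.sum_apply] at this
      rw [← Complex.ofReal_sum, this]; simp
    · simp [h0 y hyK]
  · simp only [hy, dite_false]
    rw [h0 y (fun hh => hy (hKU hh))]; simp

theorem IsCcOn.mono {U V : Set Y} {f : Y → ℂ} (h : IsCcOn U f) (hV : IsOpen V) (hT : T2Space V)
    (hUV : U ⊆ V) : IsCcOn V f := by
  obtain ⟨K, hKU, hK, h0⟩ := h.supp
  refine ⟨hV, hT, fun y hy => ?_, K, hKU.trans hUV, hK, h0⟩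
  have := tendsto_of_ultra (l := 𝓝[V] y) (m := id) (q := y) h.isOpen h.cont hKU hK h0
    (tendsto_id.mono_left nhdsWithin_le_nhds) (fun F hF ℓ hℓ hm => by
      have hy1 : Tendsto (id : Y → Y) F (𝓝 y) :=
        (tendsto_id.mono_left nhdsWithin_le_nhds).mono_left hF
      by_contra hne
      have := hT
      obtain ⟨A, B, hA, hB, h1, h2, hd⟩ := t2_separation
        (x := (⟨ℓ, hUV (hKU hℓ)⟩ : V)) (y := ⟨y, hy⟩) (fun e => hne (congrArg Subtype.val e))
      have a1 : Subtype.val '' A ∈ 𝓝 ℓ := (hV.isOpenMap_subtype_val A hA).mem_nhds ⟨_, h1, rfl⟩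
      have a2 : Subtype.val '' B ∈ 𝓝 y := (hV.isOpenMap_subtype_val B hB).mem_nhds ⟨_, h2, rfl⟩
      obtain ⟨x, hx1, hx2⟩ := (F.neBot.nonempty_of_mem (inter_mem (hm a1) (hy1 a2)))
      obtain ⟨z, hz, e1⟩ := hx1
      obtain ⟨w, hw, e2⟩ := hx2
      have : z = w := Subtype.ext (e1.trans e2.symm)
      exact Set.disjoint_left.1 hd hz (this ▸ hw))
  exact this

/-- Cutoff functions. -/
theorem exists_cutoff [LocallyCompactSpace Y] {U K : Set Y} (hU : IsOpen U) (hT : T2Space U)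
    (hK : IsCompact K) (hKU : K ⊆ U) :
    ∃ b : Y → ℝ, IsCcOn U (fun y => (b y : ℂ)) ∧ (∀ y, 0 ≤ b y) ∧ ∀ y ∈ K, b y = 1 := by
  classical
  have := hU.locallyCompactSpace
  obtain ⟨χ, h1, -, h3, h4⟩ := exists_continuous_one_zero_of_isCompact
    (preimage_compact hK hKU) isClosed_empty (Set.disjoint_empty _)
  refine ⟨fun y => if h : y ∈ U then χ ⟨y, h⟩ else 0, ?_, fun y => ?_, fun y hy => ?_⟩
  · have := isCcOn_extend hU isOpen_univ hT (fun y => (χ y : ℂ))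
      (Complex.continuous_ofReal.comp χ.continuous) (tsupport χ) h3
      (fun y hy => by simp [image_eq_zero_of_notMem_tsupport hy]) (by simp)
    rw [Set.inter_univ] at this
    convert this using 2
    split_ifs with hh <;> simp [hh]
  · dsimp only; split_ifs
    · exact (h4 _).1
    · exact le_rfl
  · simp only [hKU hy, dite_true]; exact h1 (x := ⟨y, hKU hy⟩) hy

end CcBasic

section Convolution

variable {G : Type*} [TopologicalSpace G] [TopGroupoid G]

/-- The convolution product `(f ∗ g)(x) = ∫_{G^{r(x)}} f(y) g(y⁻¹x) dλ^{r(x)}(y)`. -/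
noncomputable def conv [MeasurableSpace G] (lam : HaarSystem G) (f g : G → ℂ) (x : G) : ℂ :=
  ∫ y : Fiber (r x), f y * g (mul (inv y) x) ∂lam.meas (r x)

/-- The involution `f*(x) = conj (f(x⁻¹))`. -/
noncomputable def invol (f : G → ℂ) (x : G) : ℂ := (starRingEnd ℂ) (f (inv x))

theorem conv_eq_of_r [MeasurableSpace G] (lam : HaarSystem G) {f g : G → ℂ} {x u : G} (hx : r x = u) :
    conv lam f g x = ∫ y : Fiber u, f y * g (mul (inv y) x) ∂lam.meas u := by
  subst hx; rfl

theorem conv_smul_left [MeasurableSpace G] (lam : HaarSystem G) (c : ℂ) (f g : G → ℂ) : conv lam (c • f) g = c • conv lam f g := by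
  funext x
  simp only [conv, Pi.smul_apply, smul_eq_mul, mul_assoc]
  exact integral_const_mul _ _

theorem conv_smul_right [MeasurableSpace G] (lam : HaarSystem G) (c : ℂ) (f g : G → ℂ) : conv lam f (c • g) = c • conv lam f g := by
  funext x
  simp only [conv, Pi.smul_apply, smul_eq_mul, mul_left_comm _ c]
  exact integral_const_mul _ _

variable [LCGroupoid G]

attribute [local instance] t2_fiber lc_fiber

theorem fiber_unique {α : Type*} {F : Filter α} [F.NeBot] {f : α → G} {u x y : G}
    (hf : ∀ᶠ a in F, r (f a) = u) (h1 : Tendsto f F (𝓝 x)) (h2 : Tendsto f F (𝓝 y)) : x = y := by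
  have hx : r x = u := (isClosed_fiber u).mem_of_tendsto h1 hf
  have hy : r y = u := (isClosed_fiber u).mem_of_tendsto h2 hf
  classical
  let g : α → Fiber u := fun a => if h : r (f a) = u then ⟨f a, h⟩ else ⟨x, hx⟩
  have hg : (fun a => (g a).1) =ᶠ[F] f := by
    filter_upwards [hf] with a ha
    simp [g, ha]
  have a1 : Tendsto g F (𝓝 ⟨x, hx⟩) := tendsto_subtype_rng.2 (h1.congr' hg.symm)
  have a2 : Tendsto g F (𝓝 ⟨y, hy⟩) := tendsto_subtype_rng.2 (h2.congr' hg.symm)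
  exact congrArg Subtype.val (tendsto_nhds_unique a1 a2)

theorem comp_limit {α : Type*} {F : Filter α} [F.NeBot] {f g : α → G} {x y : G}
    (hf : Tendsto f F (𝓝 x)) (hg : Tendsto g F (𝓝 y)) (h : ∀ᶠ a in F, d (f a) = r (g a)) :
    d x = r y :=
  isClosed_comp.mem_of_tendsto (hf.prodMk_nhds hg) h

theorem r_limit {α : Type*} {F : Filter α} [F.NeBot] {f g : α → G} {x y : G}
    (hf : Tendsto f F (𝓝 x)) (hg : Tendsto g F (𝓝 y)) (h : ∀ᶠ a in F, r (f a) = r (g a)) :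
    r x = r y :=
  (isClosed_eq_units (continuous_r.comp continuous_fst) (continuous_r.comp continuous_snd)
    (fun _ => r_mem _) (fun _ => r_mem _)).mem_of_tendsto (hf.prodMk_nhds hg) h

/-- Functions in `C_c(G)` are continuous and compactly supported on each fiber. -/
theorem Cc.fiber_continuous {f : G → ℂ} (hf : f ∈ Cc G) (u : G) :
    Continuous (fun y : Fiber u => f y) :=
  continuous_iff_continuousAt.2 fun p => Cc.tendsto hf (continuous_subtype_val.tendsto p)
    fun F hF _ h => fiber_unique (u := u) (Eventually.of_forall fun a => a.2) h
      ((continuous_subtype_val.tendsto p).mono_left hF)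

theorem hasCompactSupport_fiber {u : G} {E : Type*} [Zero E] {F : Fiber u → E} {K : Set G}
    (hK : IsCompact K) (h0 : ∀ y : Fiber u, y.1 ∉ K → F y = 0) : HasCompactSupport F :=
  HasCompactSupport.intro (isCompact_fiber hK u) fun y hy => h0 y hy

theorem Cc.fiber_support {f : G → ℂ} (hf : f ∈ Cc G) (u : G) :
    HasCompactSupport (fun y : Fiber u => f y) := by
  obtain ⟨K, hK, h0⟩ := Cc.exists_compact hf
  exact hasCompactSupport_fiber hK fun y hy => h0 _ hy

/-- Extension of functions from a fiber (small support). -/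
theorem extend_fiber_of_subset {U : Set G} (hU : IsOpen U) (hT : T2Space U) {u : G}
    (F : Fiber u → ℂ) (hF : Continuous F) (S : Set (Fiber u)) (hS : IsCompact S)
    (hSU : S ⊆ Subtype.val ⁻¹' U) (h0 : ∀ y ∉ S, F y = 0) :
    ∃ f : G → ℂ, IsCcOn U f ∧ ∀ y : Fiber u, f y = F y := by
  classical
  have := locallyCompact G
  have := secondCountable G
  have := hU.locallyCompactSpace
  let A : Set U := {x | r x.1 = u}
  have hA : IsClosed A := (isClosed_fiber u).preimage continuous_subtype_val
  have hc : Continuous (fun x : A => (⟨x.1.1, x.2⟩ : Fiber u)) :=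
    (continuous_subtype_val.comp continuous_subtype_val).subtype_mk _
  obtain ⟨g, hg⟩ := ContinuousMap.exists_restrict_eq hA (⟨fun x : A => F ⟨x.1.1, x.2⟩, hF.comp hc⟩ : C(A, ℂ))
  have hK : IsCompact (Subtype.val '' S : Set G) := hS.image continuous_subtype_val
  obtain ⟨b, hb, -, hb1⟩ := exists_cutoff hU hT hK (by rintro _ ⟨y, hy, rfl⟩; exact hSU hy)
  have hbc : Continuous (fun y : U => (b y : ℂ)) := continuousOn_iff_continuous_domRestrict.1 hb.cont
  obtain ⟨L, hLU, hL, hL0⟩ := hb.supp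
  have := isCcOn_extend hU isOpen_univ hT (fun y : U => (b y : ℂ) * g y)
    (hbc.mul g.continuous) (Subtype.val ⁻¹' L) (preimage_compact hL hLU)
    (fun y hy => by rw [hL0 y hy, zero_mul]) (by simp)
  rw [Set.inter_univ] at this
  refine ⟨_, this, fun y => ?_⟩
  by_cases hy : y.1 ∈ U
  · simp only [hy, dite_true]
    have e : g ⟨y.1, hy⟩ = F y := by
      have := congrArg (fun k : C(A, ℂ) => k ⟨⟨y.1, hy⟩, y.2⟩) hg
      simpa using this
    rw [e]
    by_cases hyS : y ∈ S
    · rw [hb1 _ ⟨y, hyS, rfl⟩]; simp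
    · rw [h0 y hyS, mul_zero]
  · simp only [hy, dite_false]
    exact (h0 y fun hh => hy (hSU hh)).symm

/-- Every function in `C_c(Gᵘ)` is the restriction of a function in `C_c(G)`. -/
theorem extend_fiber {u : G} (F : Fiber u → ℂ) (hF : Continuous F) (hc : HasCompactSupport F) :
    ∃ f ∈ Cc G, ∀ y : Fiber u, f y = F y := by
  classical
  choose O hO hT hmem using exists_t2_nhd (G := G)
  obtain ⟨t, ht⟩ := hc.isCompact.elim_finite_subcover (fun y : Fiber u => Subtype.val ⁻¹' (O y))
    (fun y => (hO y).preimage continuous_subtype_val)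
    (fun y _ => Set.mem_iUnion.2 ⟨y, hmem y⟩)
  let c : Fin t.card → Fiber u := fun i => (t.equivFin.symm i).1
  obtain ⟨p, hp1, hp2, -, hp4⟩ := exists_continuous_sum_one_of_isOpen_isCompact
    (s := fun i => (Subtype.val ⁻¹' (O (c i)) : Set (Fiber u)))
    (fun i => (hO _).preimage continuous_subtype_val) hc.isCompact (by
      intro y hy
      obtain ⟨z, hz, hyz⟩ := Set.mem_iUnion₂.1 (ht hy)
      refine Set.mem_iUnion.2 ⟨t.equivFin ⟨z, hz⟩, ?_⟩
      simpa [c] using hyz)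
  have : ∀ i, ∃ f : G → ℂ, IsCcOn (O (c i)) f ∧ ∀ y : Fiber u, f y = (p i y : ℂ) * F y := fun i =>
    extend_fiber_of_subset (hO _) (hT _) (fun y => (p i y : ℂ) * F y)
      ((Complex.continuous_ofReal.comp (p i).continuous).mul hF) (tsupport (p i)) (hp4 i) (hp1 i)
      (fun y hy => by simp [image_eq_zero_of_notMem_tsupport hy])
  choose f hf1 hf2 using this
  refine ⟨∑ i, f i, Submodule.sum_mem _ fun i _ => (hf1 i).mem_Cc, fun y => ?_⟩
  rw [Finset.sum_apply]
  simp only [hf2]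
  rw [← Finset.sum_mul]
  by_cases hy : y ∈ tsupport F
  · have := hp2 hy
    rw [Finset.sum_apply] at this
    rw [← Complex.ofReal_sum, this]; simp
  · simp [image_eq_zero_of_notMem_tsupport hy]

/-- `z ↦ g(z⁻¹ x)` is continuous on each fiber; more generally `(y, z) ↦ g(z⁻¹ y)` is. -/
theorem continuous_div {g : G → ℂ} (hg : g ∈ Cc G) {u : G} :
    Continuous (fun p : Fiber u × Fiber u => g (mul (inv p.1.1) p.2.1)) := by
  refine continuous_iff_continuousAt.2 fun p => Cc.tendsto hg ?_ ?_
  · exact tendsto_mul (tendsto_inv ((continuous_subtype_val.comp continuous_fst).tendsto p))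
      ((continuous_subtype_val.comp continuous_snd).tendsto p) (by
        simp only [d_inv]; rw [p.1.2, p.2.2])
      (Eventually.of_forall fun a => by
        simp only [d_inv]; rw [a.1.2, a.2.2])
  · intro F hF ℓ h
    have h1 : Tendsto (fun a : Fiber u × Fiber u => a.1.1) F (𝓝 p.1.1) :=
      ((continuous_subtype_val.comp continuous_fst).tendsto p).mono_left hF
    have h2 : Tendsto (fun a : Fiber u × Fiber u => a.2.1) F (𝓝 p.2.1) :=
      ((continuous_subtype_val.comp continuous_snd).tendsto p).mono_left hF
    have hcomp : ∀ a : Fiber u × Fiber u, d a.1.1 = r (mul (inv a.1.1) a.2.1) := fun a => by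
      rw [r_mul _ _ (by rw [d_inv, a.1.2, a.2.2]), r_inv]
    have hcl := comp_limit h1 h (Eventually.of_forall hcomp)
    have h3 := tendsto_mul h1 h hcl (Eventually.of_forall hcomp)
    have h4 : Tendsto (fun a : Fiber u × Fiber u => a.2.1) F (𝓝 (mul p.1.1 ℓ)) :=
      h3.congr fun a => mul_inv_cancel_left _ _ (by rw [a.1.2, a.2.2])
    have h5 := fiber_unique (u := u) (Eventually.of_forall fun a => a.2.2) h2 h4
    rw [h5, inv_mul_cancel_left _ _ hcl]

theorem continuous_div_left {g : G → ℂ} (hg : g ∈ Cc G) {u x : G} (hx : r x = u) :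
    Continuous (fun y : Fiber u => g (mul (inv y.1) x)) :=
  (continuous_div hg).comp (continuous_id.prodMk (continuous_const (y := (⟨x, hx⟩ : Fiber u))))

variable [MeasurableSpace G] [BorelSpace G] (lam : HaarSystem G)

theorem HaarSystem.finite_compacts (u : G) : IsFiniteMeasureOnCompacts (lam.meas u) := by
  by_cases h : u ∈ units G
  · have := lam.regular u h; infer_instance
  · have : IsEmpty (Fiber u) := ⟨fun x => h ⟨x.1, x.2⟩⟩
    exact ⟨fun K _ => by rw [Set.eq_empty_of_isEmpty K]; simp⟩

attribute [local instance] HaarSystem.finite_compacts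

theorem conv_integrable {f g : G → ℂ} (hf : f ∈ Cc G) (hg : g ∈ Cc G) {u x : G} (hx : r x = u) :
    Integrable (fun y : Fiber u => f y * g (mul (inv y.1) x)) (lam.meas u) :=
  ((Cc.fiber_continuous hf u).mul (continuous_div_left hg hx)).integrable_of_hasCompactSupport
    (Cc.fiber_support hf u).mul_right

theorem fiber_integrable {f : G → ℂ} (hf : f ∈ Cc G) (u : G) :
    Integrable (fun y : Fiber u => f y) (lam.meas u) :=
  (Cc.fiber_continuous hf u).integrable_of_hasCompactSupport (Cc.fiber_support hf u)

theorem conv_add_left {f f' g : G → ℂ} (hf : f ∈ Cc G) (hf' : f' ∈ Cc G) (hg : g ∈ Cc G) :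
    conv lam (f + f') g = conv lam f g + conv lam f' g := by
  funext x
  simp only [conv, Pi.add_apply, add_mul]
  exact integral_add (conv_integrable lam hf hg rfl) (conv_integrable lam hf' hg rfl)

theorem conv_add_right {f g g' : G → ℂ} (hf : f ∈ Cc G) (hg : g ∈ Cc G) (hg' : g' ∈ Cc G) :
    conv lam f (g + g') = conv lam f g + conv lam f g' := by
  funext x
  simp only [conv, Pi.add_apply, mul_add]
  exact integral_add (conv_integrable lam hf hg rfl) (conv_integrable lam hf hg' rfl)

theorem integral_continuous {f : G → ℂ} (hf : f ∈ Cc G) :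
    Continuous (fun x : G => ∫ y : Fiber (r x), f y ∂lam.meas (r x)) := by
  have := LCGroupoid.t2_units (G := G)
  have h := Cc.continuous (lam.continuous_integral f hf)
  exact h.comp (continuous_r.subtype_mk r_mem)

end Convolution

section ConvolutionAlgebra

variable {G : Type*} [TopologicalSpace G] [TopGroupoid G] [LCGroupoid G]
  [MeasurableSpace G] [BorelSpace G] (lam : HaarSystem G)

attribute [local instance] t2_fiber lc_fiber HaarSystem.finite_compacts

/-- Uniform continuity estimate behind the continuity of a convolution product. -/
theorem conv_core_aux {U V W : Set G} {f g : G → ℂ} (hf : IsCcOn U f) (hg : IsCcOn V g)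
    (hW : IsOpen W) (hWT : T2Space W)
    (hUV : ∀ y ∈ U, ∀ z ∈ V, d y = r z → mul y z ∈ W) {x0 : G} (hx0 : x0 ∈ W) {a : G → ℂ}
    (ha : IsCcOn U a)
    (hax : ∀ y, r y = r x0 → a y = f y * g (mul (inv y) x0)) {K : Set G} (hK : IsCompact K)
    (hKU : K ⊆ U) {ε : ℝ} (hε : 0 < ε) :
    ∀ᶠ x in 𝓝 x0, ∀ y ∈ K, r y = r x → ‖f y * g (mul (inv y) x) - a y‖ ≤ ε := by
  classical
  by_contra hcon
  rw [not_eventually] at hcon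
  let S : Set G := {x | ∃ y ∈ K, r y = r x ∧ ε < ‖f y * g (mul (inv y) x) - a y‖}
  have hS : ∃ᶠ x in 𝓝 x0, x ∈ S := hcon.mono fun x hx => by
    push Not at hx
    exact hx
  have hne : (𝓝 x0 ⊓ 𝓟 S).NeBot := frequently_mem_iff_neBot.1 hS
  let F : Ultrafilter G := Ultrafilter.of (𝓝 x0 ⊓ 𝓟 S)
  have hF : (F : Filter G) ≤ 𝓝 x0 ⊓ 𝓟 S := Ultrafilter.of_le _
  have hFx : Tendsto id (F : Filter G) (𝓝 x0) := hF.trans inf_le_left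
  have hFS : ∀ᶠ x in (F : Filter G), x ∈ S := le_principal_iff.1 (hF.trans inf_le_right)
  let y : G → G := fun x => if h : x ∈ S then h.choose else x
  have hy : ∀ x ∈ S, y x ∈ K ∧ r (y x) = r x ∧ ε < ‖f (y x) * g (mul (inv (y x)) x) - a (y x)‖ := by
    intro x hx
    simp only [y, hx, dite_true]
    exact hx.choose_spec
  obtain ⟨p, hpK, hp⟩ := hK.ultrafilter_le_nhds (F.map y)
    (le_principal_iff.2 (hFS.mono fun x hx => (hy x hx).1))
  have hp' : Tendsto y (F : Filter G) (𝓝 p) := hp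
  have hr : r p = r x0 := r_limit hp' hFx (hFS.mono fun x hx => (hy x hx).2.1)
  obtain ⟨L, hLV, hL, hL0⟩ := hg.supp
  have hm : Tendsto (fun x => mul (inv (y x)) x) (F : Filter G) (𝓝 (mul (inv p) x0)) :=
    tendsto_mul (tendsto_inv hp') hFx (by rw [d_inv, hr])
      (hFS.mono fun x hx => by rw [d_inv]; exact (hy x hx).2.1)
  have hgl : Tendsto (fun x => g (mul (inv (y x)) x)) (F : Filter G) (𝓝 (g (mul (inv p) x0))) := by
    refine tendsto_of_ultra hg.isOpen hg.cont hLV hL hL0 hm fun F' hF' ℓ hℓ hmℓ => ?_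
    have hc : ∀ᶠ x in (F' : Filter G), d (y x) = r (mul (inv (y x)) x) :=
      hF' (hFS.mono fun x hx => by rw [r_mul _ _ (by rw [d_inv, (hy x hx).2.1]), r_inv])
    have hcl : d p = r ℓ := comp_limit (hp'.mono_left hF') hmℓ hc
    have h1 : Tendsto (fun x => mul (y x) (mul (inv (y x)) x)) (F' : Filter G) (𝓝 (mul p ℓ)) :=
      tendsto_mul (hp'.mono_left hF') hmℓ hcl hc
    have h2 : Tendsto (id : G → G) (F' : Filter G) (𝓝 (mul p ℓ)) := by
      refine h1.congr' (hF' (hFS.mono fun x hx => ?_))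
      exact mul_inv_cancel_left _ _ (hy x hx).2.1
    have h3 : Tendsto (id : G → G) (F' : Filter G) (𝓝 x0) := hFx.mono_left hF'
    have hW1 : mul p ℓ ∈ W := hUV p (hKU hpK) ℓ (hLV hℓ) hcl
    have : mul p ℓ = x0 := by
      have hev : ∀ᶠ x in (F' : Filter G), x ∈ W := h3 (hW.mem_nhds hx0)
      let q : G → W := fun x => if h : x ∈ W then ⟨x, h⟩ else ⟨x0, hx0⟩
      have hq : (fun x => (q x).1) =ᶠ[(F' : Filter G)] id := by
        filter_upwards [hev] with x hx
        simp [q, hx]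
      have a1 : Tendsto q (F' : Filter G) (𝓝 ⟨mul p ℓ, hW1⟩) := tendsto_subtype_rng.2 (h2.congr' hq.symm)
      have a2 : Tendsto q (F' : Filter G) (𝓝 ⟨x0, hx0⟩) := tendsto_subtype_rng.2 (h3.congr' hq.symm)
      exact congrArg Subtype.val (tendsto_nhds_unique a1 a2)
    rw [← this, inv_mul_cancel_left _ _ hcl]
  have hfl : Tendsto (fun x => f (y x)) (F : Filter G) (𝓝 (f p)) :=
    (hf.cont.continuousAt (hf.isOpen.mem_nhds (hKU hpK))).tendsto.comp hp'
  have hal : Tendsto (fun x => a (y x)) (F : Filter G) (𝓝 (a p)) :=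
    (ha.cont.continuousAt (ha.isOpen.mem_nhds (hKU hpK))).tendsto.comp hp'
  have hlim := ((hfl.mul hgl).sub hal).norm
  have h0 : f p * g (mul (inv p) x0) - a p = 0 := by rw [hax p hr, sub_self]
  rw [h0, norm_zero] at hlim
  have := (hlim.eventually (gt_mem_nhds hε)).and hFS
  obtain ⟨x, hx1, hx2⟩ := this.exists
  exact absurd hx1 (not_lt.2 (hy x hx2).2.2.le)

/-- If `U · V` lies in a Hausdorff open set then `C_c(U) ∗ C_c(V)` consists of elements of `C_c(G)₀`. -/
theorem conv_core {U V W : Set G} {f g : G → ℂ} (hf : IsCcOn U f) (hg : IsCcOn V g)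
    (hW : IsOpen W) (hWT : T2Space W)
    (hUV : ∀ y ∈ U, ∀ z ∈ V, d y = r z → mul y z ∈ W) : IsCcOn W (conv lam f g) := by
  have := locallyCompact G
  obtain ⟨K, hKU, hK, hK0⟩ := hf.supp
  obtain ⟨L, hLV, hL, hL0⟩ := hg.supp
  refine ⟨hW, hWT, fun x0 hx0 => ContinuousAt.continuousWithinAt ?_, _, ?_, isCompact_mul hK hL, ?_⟩
  · obtain ⟨a, ha, hax⟩ := extend_fiber_of_subset hf.isOpen hf.t2 (u := r x0)
      (fun y => f y * g (mul (inv y.1) x0))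
      ((Cc.fiber_continuous hf.mem_Cc _).mul (continuous_div_left hg.mem_Cc rfl))
      (Subtype.val ⁻¹' K) (isCompact_fiber hK _) (fun y hy => hKU hy)
      (fun y hy => by rw [hK0 y hy, zero_mul])
    obtain ⟨Ka, hKaU, hKa, hKa0⟩ := ha.supp
    obtain ⟨b, hb, hb0, hb1⟩ := exists_cutoff hf.isOpen hf.t2 (hK.union hKa) (Set.union_subset hKU hKaU)
    have hA := integral_continuous lam ha.mem_Cc
    have hB := integral_continuous lam hb.mem_Cc
    have hbi : ∀ x : G, Integrable (fun y : Fiber (r x) => b y) (lam.meas (r x)) := fun x =>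
      (fiber_integrable lam hb.mem_Cc (r x)).re
    have hB' : Continuous (fun x : G => ∫ y : Fiber (r x), b y ∂lam.meas (r x)) := by
      refine (Complex.continuous_re.comp hB).congr fun x => ?_
      simp only [Function.comp]
      rw [integral_complex_ofReal, Complex.ofReal_re]
    have key : ∀ ε > 0, ∀ᶠ x in 𝓝 x0,
        ‖conv lam f g x - ∫ y : Fiber (r x), a y ∂lam.meas (r x)‖ ≤
          ε * ∫ y : Fiber (r x), b y ∂lam.meas (r x) := by
      intro ε hε
      filter_upwards [conv_core_aux hf hg hW hWT hUV hx0 ha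
        (fun y hy => hax ⟨y, hy⟩) (hK.union hKa) (Set.union_subset hKU hKaU) hε] with x hx
      have hi := conv_integrable lam hf.mem_Cc hg.mem_Cc (x := x) rfl
      rw [conv, ← integral_sub hi (fiber_integrable lam ha.mem_Cc _), ← integral_const_mul]
      refine norm_integral_le_of_norm_le ((hbi x).const_mul ε) (Eventually.of_forall fun y => ?_)
      by_cases hy : y.1 ∈ K ∪ Ka
      · rw [hb1 _ hy, mul_one]; exact hx _ hy y.2
      · have h1 : f y.1 = 0 := hK0 _ fun h => hy (Or.inl h)
        have h2 : a y.1 = 0 := hKa0 _ fun h => hy (Or.inr h)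
        rw [h1, h2]; simpa using mul_nonneg hε.le (hb0 _)
    have hA0 : conv lam f g x0 = ∫ y : Fiber (r x0), a y ∂lam.meas (r x0) := by
      simp only [conv, hax]
    rw [ContinuousAt, Metric.tendsto_nhds]
    intro ε hε
    set B0 := ∫ y : Fiber (r x0), b y ∂lam.meas (r x0) with hB0
    have hB0n : 0 ≤ B0 := integral_nonneg fun y => hb0 _
    have hδ : 0 < ε / (2 * (B0 + 1)) := by positivity
    have e1 := hB'.continuousAt.eventually (gt_mem_nhds (show B0 < B0 + 1 by linarith))
    have e2 := (Metric.tendsto_nhds.1 (hA.tendsto x0)) (ε / 2) (by positivity)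
    filter_upwards [key _ hδ, e1, e2] with x k1 k2 k3
    rw [← hA0] at k3
    refine (dist_triangle _ (∫ y : Fiber (r x), a y ∂lam.meas (r x)) _).trans_lt ?_
    have : ε / (2 * (B0 + 1)) * (∫ y : Fiber (r x), b y ∂lam.meas (r x)) ≤ ε / 2 := by
      calc _ ≤ ε / (2 * (B0 + 1)) * (B0 + 1) := mul_le_mul_of_nonneg_left k2.le hδ.le
        _ = ε / 2 := by field_simp
    rw [dist_eq_norm]
    linarith
  · rintro _ ⟨⟨y, z⟩, ⟨⟨hy, hz⟩, hc⟩, rfl⟩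
    exact hUV y (hKU hy) z (hLV hz) hc
  · intro x hx
    refine integral_eq_zero_of_ae (Eventually.of_forall fun y => ?_)
    by_contra hne
    have hy : y.1 ∈ K := by
      by_contra h; exact hne (by simp [hK0 _ h])
    have hz : mul (inv y.1) x ∈ L := by
      by_contra h; exact hne (by simp [hL0 _ h])
    refine hx ⟨(y.1, mul (inv y.1) x), ⟨⟨hy, hz⟩, ?_⟩, mul_inv_cancel_left _ _ y.2⟩
    change d y.1 = r _
    rw [r_mul _ _ (by rw [d_inv, y.2]), r_inv]

theorem conv_sum_left {n : ℕ} (fs : Fin n → G → ℂ) (g : G → ℂ) (hf : ∀ i, fs i ∈ Cc G)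
    (hg : g ∈ Cc G) : conv lam (∑ i, fs i) g = ∑ i, conv lam (fs i) g := by
  induction n with
  | zero => simp only [Finset.univ_eq_empty, Finset.sum_empty]; funext x; simp [conv]
  | succ n ih =>
    rw [Fin.sum_univ_succ, Fin.sum_univ_succ, conv_add_left lam (hf 0)
      (Submodule.sum_mem _ fun i _ => hf i.succ) hg, ih _ fun i => hf i.succ]

theorem conv_sum_right {n : ℕ} (f : G → ℂ) (gs : Fin n → G → ℂ) (hf : f ∈ Cc G)
    (hg : ∀ i, gs i ∈ Cc G) : conv lam f (∑ i, gs i) = ∑ i, conv lam f (gs i) := by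
  induction n with
  | zero => simp only [Finset.univ_eq_empty, Finset.sum_empty]; funext x; simp [conv]
  | succ n ih =>
    rw [Fin.sum_univ_succ, Fin.sum_univ_succ, conv_add_right lam hf (hg 0)
      (Submodule.sum_mem _ fun i _ => hg i.succ), ih _ fun i => hg i.succ]

/-- Near any pair of points, products lie in a Hausdorff open set. -/
theorem exists_nhds_mul (y z : G) : ∃ A B W : Set G, IsOpen A ∧ IsOpen B ∧ IsOpen W ∧ T2Space W ∧
    y ∈ A ∧ z ∈ B ∧ ∀ p ∈ A, ∀ q ∈ B, d p = r q → mul p q ∈ W := by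
  by_cases h : d y = r z
  · obtain ⟨W, hW, hT, hm⟩ := exists_t2_nhd (mul y z)
    have h1 : ∀ᶠ p in 𝓝 (y, z), d p.1 = r p.2 → mul p.1 p.2 ∈ W :=
      eventually_nhdsWithin_iff.1 (continuousOn_mul (y, z) h (hW.mem_nhds hm))
    obtain ⟨A, hA, B, hB, hAB⟩ := mem_nhds_prod_iff.1 h1
    obtain ⟨A', hA', hAo, hyA⟩ := mem_nhds_iff.1 hA
    obtain ⟨B', hB', hBo, hzB⟩ := mem_nhds_iff.1 hB
    exact ⟨A', B', W, hAo, hBo, hW, hT, hyA, hzB, fun p hp q hq hc =>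
      hAB (Set.mk_mem_prod (hA' hp) (hB' hq)) hc⟩
  · have h1 := (isClosed_comp (G := G)).isOpen_compl.mem_nhds (x := (y, z)) h
    obtain ⟨A, hA, B, hB, hAB⟩ := mem_nhds_prod_iff.1 h1
    obtain ⟨A', hA', hAo, hyA⟩ := mem_nhds_iff.1 hA
    obtain ⟨B', hB', hBo, hzB⟩ := mem_nhds_iff.1 hB
    obtain ⟨W, hW, hT, -⟩ := exists_t2_nhd y
    exact ⟨A', B', W, hAo, hBo, hW, hT, hyA, hzB, fun p hp q hq hc =>
      absurd hc (hAB (Set.mk_mem_prod (hA' hp) (hB' hq)))⟩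

theorem conv_mem_aux {V : Set G} {g : G → ℂ} (hg : IsCcOn V g) (y : G) :
    ∃ A : Set G, IsOpen A ∧ y ∈ A ∧ ∀ (U : Set G) (f : G → ℂ), IsCcOn (U ∩ A) f → conv lam f g ∈ Cc G := by
  have := locallyCompact G
  choose A B W hA hB hW hT hyA hzB hAB using exists_nhds_mul y
  obtain ⟨n, c, gs, hgs, rfl⟩ := hg.decompose B hB hzB
  refine ⟨⋂ i, A (c i), isOpen_iInter_of_finite fun i => hA _, Set.mem_iInter.2 fun i => hyA _,
    fun U f hf => ?_⟩
  rw [conv_sum_right lam _ _ hf.mem_Cc fun i => (hgs i).mem_Cc]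
  exact Submodule.sum_mem _ fun i _ => (conv_core lam hf (hgs i) (hW (c i)) (hT (c i))
    fun p hp q hq hc => hAB _ p (Set.mem_iInter.1 hp.2 i) q hq.2 hc).mem_Cc

/-- `C_c(G)` is closed under convolution. -/
theorem conv_mem {f g : G → ℂ} (hf : f ∈ Cc G) (hg : g ∈ Cc G) : conv lam f g ∈ Cc G := by
  have := locallyCompact G
  induction hg using Submodule.span_induction with
  | mem g h =>
    obtain ⟨V, hg⟩ := h
    choose A hA hyA hconv using conv_mem_aux lam hg
    induction hf using Submodule.span_induction with
    | mem f h =>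
      obtain ⟨U, hf⟩ := h
      obtain ⟨n, c, fs, hfs, rfl⟩ := hf.decompose A hA hyA
      rw [conv_sum_left lam _ _ (fun i => (hfs i).mem_Cc) hg.mem_Cc]
      exact Submodule.sum_mem _ fun i _ => hconv _ _ _ (hfs i)
    | zero => rw [show conv lam 0 g = 0 by funext x; simp [conv]]; exact Submodule.zero_mem _
    | add f f' hf hf' h1 h2 =>
      rw [conv_add_left lam hf hf' hg.mem_Cc]; exact Submodule.add_mem _ h1 h2
    | smul c f _ h1 => rw [conv_smul_left]; exact Submodule.smul_mem _ _ h1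
  | zero => rw [show conv lam f 0 = 0 by funext x; simp [conv]]; exact Submodule.zero_mem _
  | add g g' hg hg' h1 h2 =>
    rw [conv_add_right lam hf hg hg']; exact Submodule.add_mem _ h1 h2
  | smul c g _ h1 => rw [conv_smul_right]; exact Submodule.smul_mem _ _ h1

/-- Left invariance for functions on a fiber. -/
theorem HaarSystem.invariant_fiber (x : G) (F : G → ℂ) (hF : Continuous (fun y : Fiber (r x) => F y))
    (hc : HasCompactSupport (fun y : Fiber (r x) => F y)) :
    ∫ z : Fiber (d x), F (mul x z) ∂lam.meas (d x) = ∫ y : Fiber (r x), F y ∂lam.meas (r x) := by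
  obtain ⟨f, hf, hfF⟩ := extend_fiber _ hF hc
  rw [← integral_congr_ae (Eventually.of_forall hfF), ← lam.invariant x f hf]
  refine integral_congr_ae (Eventually.of_forall fun z => ?_)
  exact (hfF ⟨mul x z, r_mul _ _ z.2.symm⟩).symm

theorem invol_mem {f : G → ℂ} (hf : f ∈ Cc G) : invol f ∈ Cc G := by
  induction hf using Submodule.span_induction with
  | mem f h =>
    obtain ⟨U, h⟩ := h
    obtain ⟨K, hKU, hK, h0⟩ := h.supp
    have e : ∀ S : Set G, inv ⁻¹' S = inv '' S := fun S => by
      ext x; constructor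
      · exact fun hx => ⟨inv x, hx, inv_inv x⟩
      · rintro ⟨y, hy, rfl⟩; simpa [inv_inv] using hy
    have := h.t2
    refine IsCcOn.mem_Cc (U := inv ⁻¹' U) ⟨h.isOpen.preimage cont_inv, ?_, ?_, inv ⁻¹' K,
      Set.preimage_mono hKU, ?_, fun y hy => ?_⟩
    · exact T2Space.of_injective_continuous
        (f := fun x : (inv ⁻¹' U : Set G) => (⟨inv x.1, x.2⟩ : U))
        (fun x y hxy => Subtype.ext (by
          have := congrArg (fun z : U => inv z.1) hxy
          simpa [inv_inv] using this))
        ((cont_inv.comp continuous_subtype_val).subtype_mk _)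
    · exact Complex.continuous_conj.comp_continuousOn
        (h.cont.comp cont_inv.continuousOn fun x hx => hx)
    · rw [e]; exact hK.image cont_inv
    · simp [invol, h0 _ hy]
  | zero => rw [show invol (0 : G → ℂ) = 0 by funext x; simp [invol]]; exact Submodule.zero_mem _
  | add f g _ _ h1 h2 =>
    rw [show invol (f + g) = invol f + invol g by funext x; simp [invol]]
    exact Submodule.add_mem _ h1 h2
  | smul c f _ h1 =>
    rw [show invol (c • f) = (starRingEnd ℂ) c • invol f by funext x; simp [invol]]
    exact Submodule.smul_mem _ _ h1

theorem invol_conv {f g : G → ℂ} (hf : f ∈ Cc G) (hg : g ∈ Cc G) :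
    invol (conv lam f g) = conv lam (invol g) (invol f) := by
  funext x
  have hg' := invol_mem hg
  have hf' := invol_mem hf
  have h := lam.invariant_fiber x (fun y => invol g y * invol f (mul (inv y) x))
    ((Cc.fiber_continuous hg' _).mul (continuous_div_left hf' rfl))
    (Cc.fiber_support hg' _).mul_right
  rw [conv, ← h, invol, conv_eq_of_r lam (r_inv x), ← integral_conj]
  refine integral_congr_ae (Eventually.of_forall fun z => ?_)
  have hz : d x = r z.1 := z.2.symm
  simp only [invol, map_mul]
  rw [inv_inv_mul _ _ (r_mul _ _ hz), inv_mul_cancel_left _ _ hz, inv_mul_rev _ _ hz, mul_comm]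

theorem conv_assoc {f g h : G → ℂ} (hf : f ∈ Cc G) (hg : g ∈ Cc G) (hh : h ∈ Cc G) :
    conv lam (conv lam f g) h = conv lam f (conv lam g h) := by
  funext x
  obtain ⟨u, hu⟩ : ∃ u, r x = u := ⟨_, rfl⟩
  obtain ⟨K, hK, hK0⟩ := Cc.exists_compact hf
  obtain ⟨L, hL, hL0⟩ := Cc.exists_compact hg
  have e1 : conv lam (conv lam f g) h x = ∫ y : Fiber u, ∫ z : Fiber u,
      f z * g (mul (inv z.1) y) * h (mul (inv y.1) x) ∂lam.meas u ∂lam.meas u := by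
    rw [conv_eq_of_r lam hu]
    refine integral_congr_ae (Eventually.of_forall fun y => ?_)
    simp only
    rw [conv_eq_of_r lam y.2, integral_mul_const]
  have e2 : conv lam f (conv lam g h) x = ∫ z : Fiber u, ∫ y : Fiber u,
      f z * g (mul (inv z.1) y) * h (mul (inv y.1) x) ∂lam.meas u ∂lam.meas u := by
    rw [conv_eq_of_r lam hu]
    refine integral_congr_ae (Eventually.of_forall fun z => ?_)
    have hz : r z.1 = u := z.2
    have hzi : d (inv z.1) = r x := by rw [d_inv, hu]; exact z.2
    simp only [mul_assoc]
    rw [integral_const_mul, conv_eq_of_r lam (u := d z.1) (by rw [r_mul _ _ hzi, r_inv])]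
    congr 1
    obtain ⟨z, rfl⟩ := z
    dsimp only at *
    have hzx : r z = r x := hu.symm
    have inva := lam.invariant_fiber z (fun y => g (mul (inv z) y) * h (mul (inv y) x))
      (((continuous_div hg).comp ((continuous_const (y := (⟨z, rfl⟩ : Fiber (r z)))).prodMk continuous_id)).mul
        (continuous_div_left hh hzx.symm))
      (by
        refine (hasCompactSupport_fiber (isCompact_mul (isCompact_singleton (x := z)) hL)
          fun y hy => ?_)
        have : g (mul (inv z) y) = 0 := hL0 _ fun hm => hy
          ⟨(z, mul (inv z) y.1), ⟨⟨rfl, hm⟩, by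
            change d z = r _; rw [r_mul _ _ (by rw [d_inv, y.2]), r_inv]⟩,
            mul_inv_cancel_left _ _ y.2.symm⟩
        rw [this, zero_mul])
    rw [← inva]
    refine integral_congr_ae (Eventually.of_forall fun w => ?_)
    have hw : d z = r w.1 := w.2.symm
    simp only
    rw [inv_mul_cancel_left _ _ hw, inv_mul_rev _ _ hw,
      assoc _ _ _ (by rw [d_inv, r_inv]; exact hw.symm) (by rw [d_inv, hzx])]
  rw [e1, e2]
  refine integral_integral_swap_of_hasCompactSupport
    (f := fun y z : Fiber u => f z * g (mul (inv z.1) y) * h (mul (inv y.1) x)) ?_ ?_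
  · exact (((Cc.fiber_continuous hf u).comp continuous_snd).mul
      ((continuous_div hg).comp continuous_swap)).mul
      ((continuous_div_left hh hu).comp continuous_fst)
  · refine HasCompactSupport.intro
      ((isCompact_fiber (isCompact_mul hK hL) u).prod (isCompact_fiber hK u)) fun p hp => ?_
    by_contra hne
    have hz : p.2.1 ∈ K := by
      by_contra hc; exact hne (by simp [Function.uncurry, hK0 _ hc])
    have hm : mul (inv p.2.1) p.1.1 ∈ L := by
      by_contra hc; exact hne (by simp [Function.uncurry, hL0 _ hc])
    have hrr : r p.2.1 = r p.1.1 := p.2.2.trans p.1.2.symm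
    refine hp ⟨⟨(p.2.1, mul (inv p.2.1) p.1.1), ⟨⟨hz, hm⟩, ?_⟩, mul_inv_cancel_left _ _ hrr⟩, hz⟩
    change d p.2.1 = r _
    rw [r_mul _ _ (by rw [d_inv, hrr]), r_inv]

end ConvolutionAlgebra

section MaximalCStarAlgebra

universe u w

variable {G : Type u} [TopologicalSpace G] [TopGroupoid G] [MeasurableSpace G]

/-- The `I`-norm `max (sup_u ∫ |f| dλᵘ, sup_u ∫ |f| dλ_u)`, where `λ_u` is the image of `λᵘ` under
inversion. -/
noncomputable def iNorm (lam : HaarSystem G) (f : G → ℂ) : ℝ≥0∞ :=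
  max (⨆ u : G, ∫⁻ y : Fiber u, ‖f y‖ₑ ∂lam.meas u)
    (⨆ u : G, ∫⁻ y : Fiber u, ‖f (inv y)‖ₑ ∂lam.meas u)

/-- The convolution algebra of a groupoid with Haar system: the vector space `C_c(G)`. -/
def ConvAlg (_lam : HaarSystem G) : Type u := Cc G

namespace ConvAlg

variable {lam : HaarSystem G}

noncomputable instance : AddCommGroup (ConvAlg lam) := inferInstanceAs (AddCommGroup (Cc G))

noncomputable instance : Module ℂ (ConvAlg lam) := inferInstanceAs (Module ℂ (Cc G))

instance : CoeFun (ConvAlg lam) (fun _ => G → ℂ) := ⟨fun f => Subtype.val f⟩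

theorem mem (f : ConvAlg lam) : (f : G → ℂ) ∈ Cc G := Subtype.property f

variable [LCGroupoid G] [BorelSpace G]

/-- The product of `C_c(G)` is convolution. -/
noncomputable instance : Mul (ConvAlg lam) := ⟨fun f g => ⟨conv lam f g, conv_mem lam f.mem g.mem⟩⟩

/-- The involution of `C_c(G)`. -/
noncomputable instance : Star (ConvAlg lam) := ⟨fun f => ⟨invol f, invol_mem f.mem⟩⟩

noncomputable instance : NonUnitalRing (ConvAlg lam) where
  left_distrib f g h := Subtype.ext (conv_add_right lam f.mem g.mem h.mem)
  right_distrib f g h := Subtype.ext (conv_add_left lam f.mem g.mem h.mem)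
  zero_mul f := Subtype.ext (by
    funext x
    change ∫ y : Fiber (r x), (0 : ℂ) * f (mul (inv y) x) ∂lam.meas (r x) = 0
    simp)
  mul_zero f := Subtype.ext (by
    funext x
    change ∫ y : Fiber (r x), f y * (0 : ℂ) ∂lam.meas (r x) = 0
    simp)
  mul_assoc f g h := Subtype.ext (conv_assoc lam f.mem g.mem h.mem)

noncomputable instance : StarRing (ConvAlg lam) where
  star_involutive f := Subtype.ext (by
    funext x
    change (starRingEnd ℂ) ((starRingEnd ℂ) (f (inv (inv x)))) = f x
    rw [inv_inv, Complex.conj_conj])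
  star_mul f g := Subtype.ext (invol_conv lam f.mem g.mem)
  star_add f g := Subtype.ext (by
    funext x
    exact map_add (starRingEnd ℂ) (f (inv x)) (g (inv x)))

instance : StarModule ℂ (ConvAlg lam) where
  star_smul c f := Subtype.ext (by
    funext x
    exact map_mul (starRingEnd ℂ) c (f (inv x)))

instance : IsScalarTower ℂ (ConvAlg lam) (ConvAlg lam) where
  smul_assoc c f g := Subtype.ext (conv_smul_left lam c f g)

instance : SMulCommClass ℂ (ConvAlg lam) (ConvAlg lam) where
  smul_comm c f g := Subtype.ext (conv_smul_right lam c f g).symm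

end ConvAlg

theorem IsCcOn.norm {Y : Type*} [TopologicalSpace Y] {U : Set Y} {f : Y → ℂ} (h : IsCcOn U f) :
    IsCcOn U (fun y => ((‖f y‖ : ℝ) : ℂ)) := by
  obtain ⟨K, hKU, hK, h0⟩ := h.supp
  exact ⟨h.isOpen, h.t2, Complex.continuous_ofReal.comp_continuousOn h.cont.norm, K, hKU, hK,
    fun y hy => by simp [h0 y hy]⟩

variable [LCGroupoid G] [BorelSpace G]

attribute [local instance] t2_fiber lc_fiber HaarSystem.finite_compacts

theorem fiber_lintegral_bounded (lam : HaarSystem G) {f : G → ℂ} (hf : f ∈ Cc G) :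
    ∃ C : NNReal, ∀ u : G, ∫⁻ y : Fiber u, ‖f y‖ₑ ∂lam.meas u ≤ C := by
  induction hf using Submodule.span_induction with
  | mem f h =>
    obtain ⟨U, h⟩ := h
    have := LCGroupoid.t2_units (G := G)
    have hn := h.norm.mem_Cc
    have hm := lam.continuous_integral _ hn
    obtain ⟨K, hK, hK0⟩ := Cc.exists_compact hm
    obtain ⟨C, hC⟩ := (hK.image (Cc.continuous hm)).isBounded.exists_norm_le
    refine ⟨Real.toNNReal C, fun u => ?_⟩
    by_cases hu : u ∈ units G
    · rw [← ofReal_integral_norm_eq_lintegral_enorm (fiber_integrable lam h.mem_Cc u)]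
      have e : ‖∫ y : Fiber u, ((‖f y‖ : ℝ) : ℂ) ∂lam.meas u‖ = ∫ y : Fiber u, ‖f y‖ ∂lam.meas u := by
        rw [integral_complex_ofReal, Complex.norm_real, Real.norm_of_nonneg]
        exact integral_nonneg fun y => norm_nonneg _
      rw [← e]
      by_cases huK : (⟨u, hu⟩ : units G) ∈ K
      · exact ENNReal.ofReal_le_ofReal (hC _ ⟨⟨u, hu⟩, huK, rfl⟩)
      · have h0 := hK0 _ huK
        dsimp only at h0
        rw [h0, norm_zero, ENNReal.ofReal_zero]
        exact zero_le
    · have : IsEmpty (Fiber u) := ⟨fun x => hu ⟨x.1, x.2⟩⟩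
      simp
  | zero => exact ⟨0, fun u => by simp⟩
  | add f g hf hg h1 h2 =>
    obtain ⟨C, hC⟩ := h1
    obtain ⟨D, hD⟩ := h2
    refine ⟨C + D, fun u => ?_⟩
    have hm : Measurable (fun y : Fiber u => ‖f y‖ₑ) := (Cc.fiber_continuous hf u).enorm.measurable
    calc ∫⁻ y : Fiber u, ‖(f + g) y‖ₑ ∂lam.meas u
        ≤ ∫⁻ y : Fiber u, (‖f y‖ₑ + ‖g y‖ₑ) ∂lam.meas u := lintegral_mono fun y => enorm_add_le _ _
      _ = _ := lintegral_add_left hm _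
      _ ≤ C + D := add_le_add (hC u) (hD u)
      _ = _ := by simp
  | smul c f hf h1 =>
    obtain ⟨C, hC⟩ := h1
    refine ⟨‖c‖₊ * C, fun u => ?_⟩
    have hm : Measurable (fun y : Fiber u => ‖f y‖ₑ) := (Cc.fiber_continuous hf u).enorm.measurable
    simp only [Pi.smul_apply, enorm_smul]
    rw [lintegral_const_mul _ hm, ENNReal.coe_mul]
    exact mul_le_mul_right (hC u) _

/-- The `I`-norm is finite on `C_c(G)`. -/
theorem iNorm_lt_top (lam : HaarSystem G) {f : G → ℂ} (hf : f ∈ Cc G) : iNorm lam f < ⊤ := by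
  obtain ⟨C, hC⟩ := fiber_lintegral_bounded lam hf
  obtain ⟨D, hD⟩ := fiber_lintegral_bounded lam (invol_mem hf)
  refine max_lt ((iSup_le hC).trans_lt ENNReal.coe_lt_top)
    (lt_of_le_of_lt (iSup_le fun u => ?_) (ENNReal.coe_lt_top (r := D)))
  refine le_trans (le_of_eq (lintegral_congr fun y => ?_)) (hD u)
  simp [invol]

/-- A `*`-representation of the convolution algebra `C_c(G)` on a Hilbert space, bounded by the
`I`-norm. -/
structure Rep (lam : HaarSystem G) where
  space : Type w
  [normedAddCommGroup : NormedAddCommGroup space]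
  [innerProductSpace : InnerProductSpace ℂ space]
  [completeSpace : CompleteSpace space]
  hom : ConvAlg lam →⋆ₙₐ[ℂ] (space →L[ℂ] space)
  bound : ∀ f : ConvAlg lam, ‖hom f‖ₑ ≤ iNorm lam f

attribute [instance] Rep.normedAddCommGroup Rep.innerProductSpace Rep.completeSpace

/-- The `ℓ^∞`-product of the algebras of bounded operators on the spaces of all representations. -/
def RepProd (lam : HaarSystem G) : Type (max u (w + 1)) :=
  lp (fun ρ : Rep.{u, w} lam => ρ.space →L[ℂ] ρ.space) ∞

noncomputable instance (lam : HaarSystem G) : NonUnitalCStarAlgebra (RepProd.{u, w} lam) :=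
  inferInstanceAs (NonUnitalCStarAlgebra (lp (fun ρ : Rep.{u, w} lam => ρ.space →L[ℂ] ρ.space) ∞))

theorem rep_memℓp (lam : HaarSystem G) (f : ConvAlg lam) :
    Memℓp (fun ρ : Rep.{u, w} lam => ρ.hom f) ∞ := by
  refine memℓp_infty ⟨(iNorm lam f).toReal, ?_⟩
  rintro _ ⟨ρ, rfl⟩
  have h := ENNReal.toReal_mono (iNorm_lt_top lam f.mem).ne (ρ.bound f)
  simpa using h

/-- The direct sum of all representations of `C_c(G)`. -/
noncomputable def universalRep (lam : HaarSystem G) : ConvAlg lam →⋆ₙₐ[ℂ] RepProd.{u, w} lam where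
  toFun f := ⟨fun ρ => ρ.hom f, rep_memℓp lam f⟩
  map_smul' c f := Subtype.ext (funext fun ρ => map_smul ρ.hom c f)
  map_zero' := Subtype.ext (funext fun ρ => map_zero ρ.hom)
  map_add' f g := Subtype.ext (funext fun ρ => map_add ρ.hom f g)
  map_mul' f g := Subtype.ext (funext fun ρ => map_mul ρ.hom f g)
  map_star' f := Subtype.ext (funext fun ρ => map_star ρ.hom f)

/-- The maximal groupoid `C*`-algebra `C*(G, λ)`: the `C*`-envelope of `C_c(G)`, i.e. its completion
in the seminorm `f ↦ sup_ρ ‖ρ(f)‖` over all representations `ρ`, realized as the norm closure of the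
image of the direct sum of all representations. -/
def MaxCStar (lam : HaarSystem G) : Type (max u (w + 1)) :=
  (NonUnitalStarAlgHom.range (universalRep.{u, w} lam)).topologicalClosure

noncomputable instance (lam : HaarSystem G) : NonUnitalCStarAlgebra (MaxCStar.{u, w} lam) :=
  NonUnitalStarSubalgebra.nonUnitalCStarAlgebra
    (h_closed := NonUnitalStarSubalgebra.isClosed_topologicalClosure _)
    (NonUnitalStarAlgHom.range (universalRep.{u, w} lam)).topologicalClosure

/-- The canonical `*`-homomorphism `C_c(G) → C*(G, λ)`, which has dense range. -/
noncomputable def MaxCStar.ofCc (lam : HaarSystem G) : ConvAlg lam →⋆ₙₐ[ℂ] MaxCStar.{u, w} lam :=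
  NonUnitalStarAlgHom.codRestrict (universalRep.{u, w} lam)
    (NonUnitalStarAlgHom.range (universalRep.{u, w} lam)).topologicalClosure
    fun f => NonUnitalStarSubalgebra.le_topologicalClosure _ ⟨f, rfl⟩

theorem MaxCStar.denseRange_ofCc (lam : HaarSystem G) : DenseRange (MaxCStar.ofCc.{u, w} lam) := by
  intro x
  refine closure_subtype.2 (closure_mono ?_ x.2)
  rintro _ ⟨f, rfl⟩
  exact ⟨_, ⟨f, rfl⟩, rfl⟩

theorem MaxCStar.norm_ofCc (lam : HaarSystem G) (f : ConvAlg lam) :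
    ‖MaxCStar.ofCc.{u, w} lam f‖ = ⨆ ρ : Rep.{u, w} lam, ‖ρ.hom f‖ :=
  lp.norm_eq_ciSup (universalRep.{u, w} lam f)

end MaximalCStarAlgebra

section Covering

universe u v

variable {G : Type u} {H : Type v} [TopologicalSpace G] [TopGroupoid G] [TopologicalSpace H]
  [TopGroupoid H]

/-- A groupoid homomorphism: it intertwines `d`, `r` and the multiplication (hence preserves units). -/
structure IsGroupoidHom (π : G → H) : Prop where
  map_d : ∀ x, π (d x) = d (π x)
  map_r : ∀ x, π (r x) = r (π x)
  map_mul : ∀ x y, d x = r y → π (mul x y) = mul (π x) (π y)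

theorem IsGroupoidHom.map_units {π : G → H} (h : IsGroupoidHom π) (u : units G) :
    π u ∈ units H := by
  obtain ⟨_, x, rfl⟩ := u
  exact ⟨π x, (h.map_r x).symm⟩

/-- A fiberwise groupoid covering map. -/
structure IsFiberwiseCovering (π : G → H) : Prop where
  hom : IsGroupoidHom π
  units_homeo : IsHomeomorph (fun u : units G => (⟨π u, hom.map_units u⟩ : units H))
  surjective : Function.Surjective π
  localHomeo : IsLocalHomeomorph π

/-- The restriction `Gᵘ → H^{π(u)}` of a groupoid homomorphism. -/
def IsGroupoidHom.fiberMap {π : G → H} (h : IsGroupoidHom π) (u : G) (x : Fiber u) : Fiber (π u) :=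
  ⟨π x, by rw [← h.map_r, x.2]⟩

/-- `π` intertwines the Haar systems: for each unit `u` and each open `U ⊆ G` on which `π` is a
homeomorphism onto its image, the push-forward of `λ_Gᵘ` restricted to `U ∩ Gᵘ` is `λ_H^{π(u)}`
restricted to `π(U) ∩ H^{π(u)}`. -/
def IntertwinesHaar [MeasurableSpace G] [MeasurableSpace H] {π : G → H} (h : IsFiberwiseCovering π)
    (lamG : HaarSystem G) (lamH : HaarSystem H) : Prop :=
  ∀ u ∈ units G, ∀ U : Set G, IsOpen U → Topology.IsEmbedding (U.domRestrict π) →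
    ((lamG.meas u).restrict {x | x.1 ∈ U}).map (h.hom.fiberMap u) =
      (lamH.meas (π u)).restrict {y | y.1 ∈ π '' U}

/-- `π_*(f)(y) = ∑_{x ∈ π⁻¹(y)} f(x)`, the sum of `f` over the fibers of `π` (which has only finitely
many nonzero terms if `f ∈ C_c(G)`). -/
noncomputable def fiberSum (π : G → H) (f : G → ℂ) (y : H) : ℂ := ∑ᶠ x ∈ π ⁻¹' {y}, f x

end Covering

end FiberwiseCovering

universe u v w

/-! A compact subset of $G$ is covered by finitely many sets on which $\pi$ is injective, so it
meets each fibre of $\pi$ in a finite set, and $\pi_*$ is well defined. Everything about membership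
in $C_c$ is local: by a partition of unity (`Cc_eq_span`) $C_c$ is spanned by functions supported in
small open sets. On an open set mapped injectively, $\pi_*$ merely transports a function along a
homeomorphism, which gives both $\pi_*(C_c(G))\subset C_c(H)$ and surjectivity.

Multiplicativity rests on two facts. Since $\pi$ is injective on units, composability lifts from $H$
to $G$; hence, if $y\in H$ has range $\pi(u)$ and $z\in G^u$, then $x\mapsto z^{-1}x$ is a bijection
from $\pi^{-1}(y)$ to $\pi^{-1}(\pi(z)^{-1}y)$. Since $\pi$ intertwines the Haar systems, $\int
\pi_*(f)\,k\,d\lambda_H^{\pi(u)}=\int f\cdot(k\circ\pi)\,d\lambda_G^u$ for bounded measurable $k$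
(`integral_fiberSum_mul`). Interchanging a finite sum with the integral then turns $\pi_*(f*g)$ into
$\pi_*(f)*\pi_*(g)$ (`fiberSum_conv`). Taking for $k$ the conjugate phase of $\pi_*(f)$, the same
formula shows that $\pi_*$ does not increase the $I$-norm (`iNorm_fiberSum_le`).

Consequently every admissible representation of $C_c(H)$ pulls back to one of $C_c(G)$, and $\pi_*$
extends to the envelopes (`MaxCStar.map`). The extension has dense range, and a $*$-homomorphism of
$C^*$-algebras with dense range is onto (`surjective_of_denseRange`): functional calculus provides
lifts with a uniform norm bound, and completeness does the rest. -/

namespace FiberwiseCovering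

open MeasureTheory Filter Topology TopGroupoid
open scoped ENNReal

/-! ### Surjectivity of $*$-homomorphisms with dense range -/

section CStar

variable {A B : Type*} [NonUnitalCStarAlgebra A] [NonUnitalCStarAlgebra B]

/-- A self-adjoint element can be changed modulo the kernel of a `*`-homomorphism so that its norm
does not exceed the norm of its image. -/
theorem exists_selfAdjoint_lift (φ : A →⋆ₙₐ[ℂ] B) (hφ : Continuous φ) {a : A}
    (ha : IsSelfAdjoint a) : ∃ a' : A, φ a' = φ a ∧ ‖a'‖ ≤ ‖φ a‖ := by
  set c := ‖φ a‖
  have hc : 0 ≤ c := norm_nonneg _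
  -- Clamping to $[-c,c]$: since $|f|\le c$, the element $f(a)$ has norm at most $c$; since $f$ is
  -- the identity on the spectrum of $\varphi(a)$, which lies in $[-c,c]$, the image is unchanged.
  -- The non-unital calculus requires $f(0)=0$.
  let f : ℝ → ℝ := fun x => max (-c) (min c x)
  have hf : Continuous f := by fun_prop
  have hf0 : f 0 = 0 := by simp [f, hc]
  have hφa : IsSelfAdjoint (φ a) := ha.map φ
  refine ⟨cfcₙ f a, ?_, ?_⟩
  · rw [φ.map_cfcₙ f a hf.continuousOn hf0 hφ ha hφa]
    conv_rhs => rw [← cfcₙ_id' ℝ (φ a)]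
    refine cfcₙ_congr fun x hx => ?_
    have hx' : ‖x‖ ≤ c := by
      have := norm_apply_le_norm_cfcₙ (fun x : ℝ => x) (φ a) hx
      rwa [cfcₙ_id' ℝ (φ a)] at this
    obtain ⟨h1, h2⟩ := abs_le.1 hx'
    simp [f, h1, h2]
  · refine norm_cfcₙ_le fun x _ => ?_
    rw [Real.norm_eq_abs, abs_le]
    exact ⟨le_max_left _ _, max_le (by linarith) (min_le_left _ _)⟩

/-- Real and imaginary parts are lifted separately and each image has norm at most `‖φ a‖`, whence
the factor 2. Any uniform constant would serve the closed-range argument. -/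
theorem exists_lift_norm_le (φ : A →⋆ₙₐ[ℂ] B) (hφ : Continuous φ) (a : A) :
    ∃ a' : A, φ a' = φ a ∧ ‖a'‖ ≤ 2 * ‖φ a‖ := by
  obtain ⟨x, hx, hxn⟩ := exists_selfAdjoint_lift φ hφ (realPart a).2
  obtain ⟨y, hy, hyn⟩ := exists_selfAdjoint_lift φ hφ (imaginaryPart a).2
  have hre : φ (realPart a : A) = (realPart (φ a) : B) := by
    simp [realPart_apply_coe, map_star, ← Complex.coe_smul]
  have him : φ (imaginaryPart a : A) = (imaginaryPart (φ a) : B) := by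
    simp [imaginaryPart_apply_coe, map_star, ← Complex.coe_smul]
  refine ⟨x + Complex.I • y, ?_, ?_⟩
  · rw [map_add, map_smul, hx, hy, ← map_smul, ← map_add, realPart_add_I_smul_imaginaryPart]
  · rw [hre] at hxn
    rw [him] at hyn
    calc ‖x + Complex.I • y‖ ≤ ‖x‖ + ‖y‖ := (norm_add_le _ _).trans (by simp [norm_smul])
      _ ≤ ‖φ a‖ + ‖φ a‖ := add_le_add (hxn.trans (realPart.norm_le (φ a)))
          (hyn.trans (imaginaryPart.norm_le (φ a)))
      _ = 2 * ‖φ a‖ := by ring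

/-- A `*`-homomorphism of `C*`-algebras with dense range is surjective. -/
theorem surjective_of_denseRange (φ : A →⋆ₙₐ[ℂ] B) (h : DenseRange φ) :
    Function.Surjective φ := by
  have hb : ∀ a, ‖φ a‖ ≤ 1 * ‖a‖ := fun a => by
    rw [one_mul]; exact NonUnitalStarAlgHom.norm_apply_le φ a
  have hφ : Continuous φ := AddMonoidHomClass.continuous_of_bound φ 1 hb
  let F : NormedAddGroupHom A B := (φ : A →+ B).mkNormedAddGroupHom 1 hb
  have hF : F.SurjectiveOnWith (φ : A →+ B).range 2 := by
    rintro _ ⟨a, rfl⟩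
    exact exists_lift_norm_le φ hφ a
  intro b
  -- Successive approximations of `b` from the range lift to an absolutely convergent series in `A`.
  -- The loss of 1 in the constant is arbitrary.
  obtain ⟨a, ha, -⟩ := controlled_closure_of_complete two_pos one_pos hF b (h b)
  exact ⟨a, ha⟩

end CStar

/-! ### Localization and boundedness in $C_c(Y)$ -/

section CcLocal

variable {Y : Type*} [TopologicalSpace Y]

/-- `C_c(Y)` is spanned by the functions in `C_c(Y)₀` subordinate to a given open cover. -/
theorem Cc_eq_span [LocallyCompactSpace Y] (O : Y → Set Y) (hO : ∀ y, IsOpen (O y))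
    (hmem : ∀ y, y ∈ O y) : Cc Y = Submodule.span ℂ {f | ∃ y, ∃ U ⊆ O y, IsCcOn U f} := by
  apply le_antisymm
  · refine Submodule.span_le.2 ?_
    rintro f ⟨U, h⟩
    obtain ⟨n, c, fs, hfs, rfl⟩ := h.decompose O hO hmem
    exact Submodule.sum_mem _ fun i _ =>
      Submodule.subset_span ⟨c i, _, Set.inter_subset_right, hfs i⟩
  · refine Submodule.span_mono ?_
    rintro f ⟨y, U, -, h⟩
    exact ⟨U, h⟩

/-- A general element of $C_c(Y)$ need not be continuous, so compactness yields a bound only for the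
generators, and the bound then passes to linear combinations. -/
theorem Cc.exists_bound {f : Y → ℂ} (hf : f ∈ Cc Y) : ∃ C : ℝ, ∀ y, ‖f y‖ ≤ C := by
  induction hf using Submodule.span_induction with
  | mem f h =>
    obtain ⟨U, h⟩ := h
    obtain ⟨K, hKU, hK, h0⟩ := h.supp
    obtain ⟨C, hC⟩ := (hK.image_of_continuousOn (h.cont.mono hKU)).isBounded.exists_norm_le
    refine ⟨max C 0, fun y => ?_⟩
    by_cases hy : y ∈ K
    · exact (hC _ ⟨y, hy, rfl⟩).trans (le_max_left _ _)
    · rw [h0 y hy, norm_zero]; exact le_max_right _ _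
  | zero => exact ⟨0, fun y => by simp⟩
  | add f g _ _ h1 h2 =>
    obtain ⟨C, hC⟩ := h1
    obtain ⟨D, hD⟩ := h2
    exact ⟨C + D, fun y => (norm_add_le _ _).trans (add_le_add (hC y) (hD y))⟩
  | smul c f _ h1 =>
    obtain ⟨C, hC⟩ := h1
    exact ⟨‖c‖ * C, fun y => by
      simpa only [Pi.smul_apply, norm_smul] using mul_le_mul_of_nonneg_left (hC y) (norm_nonneg c)⟩

end CcLocal

/-! ### Fibre sums along a local homeomorphism -/

section FiberSum

variable {G H : Type*} {π : G → H}

/-- The set `T` may exceed the support of `f` in the fibre. This freedom matters for convolutions,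
where `T` is chosen before integrating. -/
theorem fiberSum_eq_sum {f : G → ℂ} {y : H} {T : Finset G} (h1 : ∀ x ∈ T, π x = y)
    (h2 : ∀ x, π x = y → f x ≠ 0 → x ∈ T) : fiberSum π f y = ∑ x ∈ T, f x := by
  refine finsum_mem_eq_sum_of_inter_support_eq _ ?_
  ext x
  simp only [Set.mem_inter_iff, Set.mem_preimage, Set.mem_singleton_iff, Function.mem_support,
    Finset.mem_coe]
  exact ⟨fun h => ⟨h2 x h.1 h.2, h.2⟩, fun h => ⟨h1 x h.1, h.2⟩⟩

/-- Finiteness is essential: a `finsum` with infinite support has the default value 0, which would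
destroy additivity. -/
theorem fiberSum_add {f g : G → ℂ} {y : H} (hf : {x | π x = y ∧ f x ≠ 0}.Finite)
    (hg : {x | π x = y ∧ g x ≠ 0}.Finite) :
    fiberSum π (f + g) y = fiberSum π f y + fiberSum π g y :=
  finsum_mem_add_distrib' hf hg

theorem fiberSum_zero : fiberSum π (0 : G → ℂ) = 0 := by
  funext y
  rw [fiberSum_eq_sum (T := ∅) (by simp) (by simp)]
  simp

theorem fiberSum_smul (c : ℂ) (f : G → ℂ) : fiberSum π (c • f) = c • fiberSum π f := by
  funext y
  simp only [fiberSum, Pi.smul_apply, smul_eq_mul]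
  -- The sum over a fibre is a nested `finsum`, over points and over proofs of membership, so the
  -- scalar is moved through twice.
  rw [← smul_eq_mul, smul_finsum]
  refine finsum_congr fun x => ?_
  rw [smul_finsum]; rfl

theorem fiberSum_apply_of_injOn {U : Set G} (hU : U.InjOn π) {f : G → ℂ} (h0 : ∀ x ∉ U, f x = 0)
    {x : G} (hx : x ∈ U) : fiberSum π f (π x) = f x := by
  rw [fiberSum_eq_sum (T := {x}) (by simp), Finset.sum_singleton]
  intro x' h1 h2
  have hx' : x' ∈ U := by
    by_contra h
    exact h2 (h0 _ h)
  exact Finset.mem_singleton.2 (hU hx' hx h1)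

theorem fiberSum_eq_zero {U : Set G} {f : G → ℂ} (h0 : ∀ x ∉ U, f x = 0) {y : H}
    (hy : y ∉ π '' U) : fiberSum π f y = 0 := by
  rw [fiberSum_eq_sum (T := ∅) (by simp), Finset.sum_empty]
  intro x h1 h2
  refine absurd (h0 x fun h => hy ⟨x, h, h1⟩) h2

variable [TopologicalSpace G] [TopologicalSpace H]

/-- Finitely many neighbourhoods on which $\pi$ is injective cover `K`, and each contains at most
one point of the fibre. -/
theorem finite_fiber_inter (hπ : IsLocalHomeomorph π) {K : Set G} (hK : IsCompact K) (y : H) :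
    {x | π x = y ∧ x ∈ K}.Finite := by
  choose O hmem hO using isLocalHomeomorph_iff_isOpenEmbedding_restrict.1 hπ
  obtain ⟨t, -, ht⟩ := hK.elim_nhds_subcover O fun x _ => hmem x
  refine (t.finite_toSet.biUnion (t := fun i => {x | π x = y ∧ x ∈ O i}) fun i _ => ?_).subset ?_
  · refine Set.Subsingleton.finite fun a ha b hb => ?_
    exact Set.injOn_iff_injective.2 (hO i).injective ha.2 hb.2 (ha.1.trans hb.1.symm)
  · rintro x ⟨h1, h2⟩
    obtain ⟨i, hi, hx⟩ := Set.mem_iUnion₂.1 (ht h2)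
    exact Set.mem_biUnion hi ⟨h1, hx⟩

theorem Cc.finite_fiber (hπ : IsLocalHomeomorph π) {f : G → ℂ} (hf : f ∈ Cc G) (y : H) :
    {x | π x = y ∧ f x ≠ 0}.Finite := by
  obtain ⟨K, hK, h0⟩ := Cc.exists_compact hf
  refine (finite_fiber_inter hπ hK y).subset fun x hx => ⟨hx.1, ?_⟩
  by_contra h
  exact hx.2 (h0 x h)

theorem Cc.fiberSum_add (hπ : IsLocalHomeomorph π) {f g : G → ℂ} (hf : f ∈ Cc G) (hg : g ∈ Cc G) :
    fiberSum π (f + g) = fiberSum π f + fiberSum π g :=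
  funext fun y => FiberwiseCovering.fiberSum_add (Cc.finite_fiber hπ hf y) (Cc.finite_fiber hπ hg y)

/-- Every point has an open neighbourhood on which a local homeomorphism is an open embedding. -/
theorem exists_open_isOpenEmbedding (hπ : IsLocalHomeomorph π) (x : G) :
    ∃ O : Set G, IsOpen O ∧ x ∈ O ∧ IsOpenEmbedding (O.domRestrict π) := by
  obtain ⟨O, hO, h⟩ := isLocalHomeomorph_iff_isOpenEmbedding_restrict.1 hπ x
  exact ⟨interior O, isOpen_interior, mem_interior_iff_mem_nhds.2 hO,
    h.comp (.inclusion interior_subset (isOpen_interior.preimage continuous_subtype_val))⟩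

/-- Here $\pi$ is a homeomorphism of $U$ onto the open set $\pi(U)$, and the fibre sum is $f$
transported along its inverse; Hausdorffness, continuity and compact support are carried along. -/
theorem IsCcOn.fiberSum (hπ : IsLocalHomeomorph π) {U : Set G} {f : G → ℂ} (h : IsCcOn U f)
    (hU : U.InjOn π) : IsCcOn (π '' U) (fiberSum π f) := by
  obtain ⟨K, hKU, hK, h0⟩ := h.supp
  have h0U : ∀ x ∉ U, f x = 0 := fun x hx => h0 x fun hK => hx (hKU hK)
  have hoe : IsOpenEmbedding (U.domRestrict π) :=
    .of_continuous_injective_isOpenMap (hπ.continuous.comp continuous_subtype_val)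
      (Set.injOn_iff_injective.1 hU) (hπ.isOpenMap.comp h.isOpen.isOpenMap_subtype_val)
  refine ⟨hπ.isOpenMap _ h.isOpen, ?_, ?_, π '' K, Set.image_mono hKU, hK.image hπ.continuous, ?_⟩
  · have := h.t2
    rw [← Set.range_domRestrict]
    exact hoe.isEmbedding.toHomeomorph.symm.isEmbedding.t2Space
  · rintro _ ⟨x, hx, rfl⟩
    refine ContinuousAt.continuousWithinAt ?_
    -- A local homeomorphism carries the neighbourhood filter of `x` to that of `π x`, so continuity
    -- is tested after composing with `π`, where the fibre sum is `f` itself near `x`.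
    rw [ContinuousAt, ← hπ.map_nhds_eq, tendsto_map'_iff, fiberSum_apply_of_injOn hU h0U hx]
    refine Tendsto.congr' ?_ (h.cont.continuousAt (h.isOpen.mem_nhds hx))
    filter_upwards [h.isOpen.mem_nhds hx] with z hz
    exact (fiberSum_apply_of_injOn hU h0U hz).symm
  · intro y hy
    exact fiberSum_eq_zero h0 hy

/-- The lift is $g\circ\pi$ cut off to $O$: each point of $\pi(O)$ has exactly one preimage in $O$,
and $g$ vanishes outside $\pi(O)$. -/
theorem IsCcOn.exists_lift (hπ : IsLocalHomeomorph π) {O : Set G} (hO : IsOpen O)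
    (hinj : O.InjOn π) {V : Set H} {g : H → ℂ} (h : IsCcOn V g) (hV : V ⊆ π '' O) :
    ∃ f ∈ Cc G, FiberwiseCovering.fiberSum π f = g := by
  classical
  obtain ⟨K, hKV, hK, h0⟩ := h.supp
  have h0O : ∀ x ∉ O, O.indicator (g ∘ π) x = 0 := fun x hx => Set.indicator_of_notMem hx _
  have hoe : IsOpenEmbedding (O.domRestrict π) :=
    .of_continuous_injective_isOpenMap (hπ.continuous.comp continuous_subtype_val)
      (Set.injOn_iff_injective.1 hinj) (hπ.isOpenMap.comp hO.isOpenMap_subtype_val)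
  refine ⟨O.indicator (g ∘ π), IsCcOn.mem_Cc (U := O ∩ π ⁻¹' V)
    ⟨hO.inter (h.isOpen.preimage hπ.continuous), ?_, ?_, O ∩ π ⁻¹' K,
      Set.inter_subset_inter_right _ (Set.preimage_mono hKV), ?_, ?_⟩, ?_⟩
  · have := h.t2
    exact T2Space.of_injective_continuous
      (f := fun x : (O ∩ π ⁻¹' V : Set G) => (⟨π x.1, x.2.2⟩ : V))
      (fun x y hxy => Subtype.ext (hinj x.2.1 y.2.1 (congrArg Subtype.val hxy)))
      ((hπ.continuous.comp continuous_subtype_val).subtype_mk _)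
  · refine ContinuousOn.congr (f := g ∘ π) ?_ fun x hx => Set.indicator_of_mem hx.1 _
    exact h.cont.comp hπ.continuous.continuousOn fun x hx => hx.2
  -- Compactness is checked inside `O`, where `π` is an embedding whose range contains `K`.
  · have hK' : IsCompact (O.domRestrict π ⁻¹' K) := by
      rw [hoe.isInducing.isCompact_iff, Set.image_preimage_eq_of_subset]
      · exact hK
      · rw [Set.range_domRestrict]
        exact hKV.trans hV
    have := hK'.image continuous_subtype_val
    convert this using 1
    ext x
    simp [and_comm]
  · intro x hx
    by_cases hxO : x ∈ O
    · rw [Set.indicator_of_mem hxO]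
      exact h0 _ fun hK => hx ⟨hxO, hK⟩
    · exact h0O x hxO
  · funext y
    by_cases hy : y ∈ π '' O
    · obtain ⟨x, hx, rfl⟩ := hy
      rw [fiberSum_apply_of_injOn hinj h0O hx, Set.indicator_of_mem hx]
      rfl
    · rw [fiberSum_eq_zero h0O hy, h0 y fun hK => hy (hV (hKV hK))]

theorem fiberSum_mem [LocallyCompactSpace G] (hπ : IsLocalHomeomorph π) {f : G → ℂ}
    (hf : f ∈ Cc G) : fiberSum π f ∈ Cc H := by
  choose O hO hmem hOe using exists_open_isOpenEmbedding hπ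
  rw [Cc_eq_span O hO hmem] at hf
  -- The induction runs over the span of the small generators; `hle` recovers membership in `Cc G`,
  -- on which additivity of the fibre sum depends.
  have hle := (Cc_eq_span O hO hmem).ge
  induction hf using Submodule.span_induction with
  | mem f h =>
    obtain ⟨x, U, hU, h⟩ := h
    exact (h.fiberSum hπ ((Set.injOn_iff_injective.2 (hOe x).injective).mono hU)).mem_Cc
  | zero => rw [fiberSum_zero]; exact Submodule.zero_mem _
  | add f g hf hg h1 h2 =>
    rw [Cc.fiberSum_add hπ (hle hf) (hle hg)]; exact Submodule.add_mem _ h1 h2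
  | smul c f _ h1 => rw [fiberSum_smul]; exact Submodule.smul_mem _ _ h1

theorem exists_fiberSum_eq [LocallyCompactSpace H] (hπ : IsLocalHomeomorph π)
    (hs : Function.Surjective π) {g : H → ℂ} (hg : g ∈ Cc H) :
    ∃ f ∈ Cc G, fiberSum π f = g := by
  choose O hO hmem hOe using exists_open_isOpenEmbedding hπ
  -- One preimage is chosen for each point of `H`; the open images of injectivity neighbourhoods of
  -- these preimages cover `H`, and functions subordinate to this cover lift directly.
  rw [Cc_eq_span (fun y => π '' O (Function.surjInv hs y)) (fun y => hπ.isOpenMap _ (hO _))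
    (fun y => ⟨_, hmem _, Function.surjInv_eq hs y⟩)] at hg
  induction hg using Submodule.span_induction with
  | mem g h =>
    obtain ⟨y, V, hV, h⟩ := h
    exact h.exists_lift hπ (hO _) (Set.injOn_iff_injective.2 (hOe _).injective) hV
  | zero => exact ⟨0, Submodule.zero_mem _, fiberSum_zero⟩
  | add g g' _ _ h1 h2 =>
    obtain ⟨f, hf, rfl⟩ := h1
    obtain ⟨f', hf', rfl⟩ := h2
    exact ⟨f + f', Submodule.add_mem _ hf hf', Cc.fiberSum_add hπ hf hf'⟩
  | smul c g _ h1 =>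
    obtain ⟨f, hf, rfl⟩ := h1
    exact ⟨c • f, Submodule.smul_mem _ _ hf, fiberSum_smul c f⟩

end FiberSum

/-! ### Compatibility with the convolution algebras and the $I$-norm -/

section CoveringAlgebra

variable {G : Type u} {H : Type v} [TopologicalSpace G] [TopGroupoid G] [TopologicalSpace H]
  [TopGroupoid H] {π : G → H}

theorem IsGroupoidHom.map_inv (h : IsGroupoidHom π) (x : G) : π (inv x) = inv (π x) := by
  have h1 : mul (π x) (π (inv x)) = r (π x) := by
    rw [← h.map_mul _ _ (r_inv x).symm, mul_inv_self, h.map_r]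
  have h2 : d (π x) = r (π (inv x)) := by rw [← h.map_d, ← h.map_r, r_inv]
  have h3 := inv_mul_cancel_left (π x) (π (inv x)) h2
  rw [h1, ← d_inv (π x), mul_id] at h3
  exact h3.symm

/-- This lifts composability from `H` to `G` and shows that all points over a given `y` have the
same range. -/
theorem IsFiberwiseCovering.units_injOn (hπ : IsFiberwiseCovering π) : (units G).InjOn π :=
  fun u hu v hv h => congrArg Subtype.val
    (hπ.units_homeo.injective (a₁ := ⟨u, hu⟩) (a₂ := ⟨v, hv⟩) (Subtype.ext h))

theorem IsFiberwiseCovering.exists_unit (hπ : IsFiberwiseCovering π) {v : H} (hv : v ∈ units H) :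
    ∃ u ∈ units G, π u = v := by
  obtain ⟨u, hu⟩ := hπ.units_homeo.surjective ⟨v, hv⟩
  exact ⟨u.1, u.2, congrArg Subtype.val hu⟩

/-- Inversion is a bijection between the fibres of $\pi$ over $y^{-1}$ and over $y$. -/
theorem fiberSum_invol (hπ : IsFiberwiseCovering π) {f : G → ℂ} (hf : f ∈ Cc G) :
    fiberSum π (invol f) = invol (fiberSum π f) := by
  classical
  funext y
  let T := (Cc.finite_fiber hπ.localHomeo hf (inv y)).toFinset
  have hT : ∀ x, x ∈ T ↔ π x = inv y ∧ f x ≠ 0 := fun x => by simp [T]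
  rw [invol, fiberSum_eq_sum (f := f) (T := T) (fun x hx => ((hT x).1 hx).1)
    (fun x h1 h2 => (hT x).2 ⟨h1, h2⟩), map_sum, fiberSum_eq_sum (T := T.image inv),
    Finset.sum_image]
  · simp [invol, inv_inv]
  · intro a _ b _ h
    rw [← inv_inv a, h, inv_inv]
  · intro x hx
    obtain ⟨z, hz, rfl⟩ := Finset.mem_image.1 hx
    rw [hπ.hom.map_inv, ((hT z).1 hz).1, inv_inv]
  · intro x h1 h2
    refine Finset.mem_image.2 ⟨inv x, (hT _).2 ⟨?_, fun h => h2 (by simp [invol, h])⟩, inv_inv x⟩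
    rw [hπ.hom.map_inv, h1]

theorem continuous_fiberMap (hπ : IsFiberwiseCovering π) (u : G) :
    Continuous (hπ.hom.fiberMap u) :=
  (hπ.localHomeo.continuous.comp continuous_subtype_val).subtype_mk _

/-- If the integrand does not vanish at $y$, then $y\in K$ and $y^{-1}x\in L$, so $x=y(y^{-1}x)\in
KL$. -/
theorem mem_mul_of_conv_ne_zero [MeasurableSpace G] {lamG : HaarSystem G} {f g : G → ℂ}
    {K L : Set G} (hK0 : ∀ y ∉ K, f y = 0)
    (hL0 : ∀ y ∉ L, g y = 0) {x : G} (hx : conv lamG f g x ≠ 0) :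
    x ∈ (fun p : G × G => mul p.1 p.2) '' (K ×ˢ L ∩ {p | d p.1 = r p.2}) := by
  contrapose! hx
  refine integral_eq_zero_of_ae (Eventually.of_forall fun y => ?_)
  by_contra hne
  have hy : y.1 ∈ K := by
    by_contra h; exact hne (by simp [hK0 _ h])
  have hz : mul (inv y.1) x ∈ L := by
    by_contra h; exact hne (by simp [hL0 _ h])
  refine hx ⟨(y.1, mul (inv y.1) x), ⟨⟨hy, hz⟩, ?_⟩, mul_inv_cancel_left _ _ y.2⟩
  change d y.1 = r _
  rw [r_mul _ _ (by rw [d_inv, y.2]), r_inv]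

variable [LCGroupoid G] [MeasurableSpace G] [BorelSpace G] [LCGroupoid H] [MeasurableSpace H]
  [BorelSpace H] {lamG : HaarSystem G} {lamH : HaarSystem H}

attribute [local instance] locallyCompact t2_fiber lc_fiber HaarSystem.finite_compacts

theorem fiber_integrable_mul {f : G → ℂ} (hf : f ∈ Cc G) {u : G} {k : Fiber u → ℂ}
    (hk : Measurable k) {C : ℝ} (hC : ∀ y, ‖k y‖ ≤ C) :
    Integrable (fun x : Fiber u => f x * k x) (lamG.meas u) :=
  (fiber_integrable lamG hf u).mul_bdd hk.aestronglyMeasurable (Eventually.of_forall hC)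

/-- Change of variables along a fiberwise covering. -/
theorem integral_fiberSum_mul (hπ : IsFiberwiseCovering π) (hlam : IntertwinesHaar hπ lamG lamH)
    {u : G} (hu : u ∈ units G) {f : G → ℂ} (hf : f ∈ Cc G) {k : Fiber (π u) → ℂ}
    (hk : Measurable k) {C : ℝ} (hC : ∀ y, ‖k y‖ ≤ C) :
    ∫ y : Fiber (π u), fiberSum π f y * k y ∂lamH.meas (π u) =
      ∫ x : Fiber u, f x * k (hπ.hom.fiberMap u x) ∂lamG.meas u := by
  have hm := (continuous_fiberMap hπ u).measurable
  choose O hO hmem hOe using exists_open_isOpenEmbedding hπ.localHomeo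
  rw [Cc_eq_span O hO hmem] at hf
  have hle := (Cc_eq_span O hO hmem).ge
  induction hf using Submodule.span_induction with
  | mem f h =>
    obtain ⟨x, U, hU, h⟩ := h
    obtain ⟨K, hKU, -, h0⟩ := h.supp
    have h0U : ∀ x ∉ U, f x = 0 := fun x hx => h0 x fun hK => hx (hKU hK)
    have hinj : U.InjOn π := (Set.injOn_iff_injective.2 (hOe x).injective).mono hU
    have hemb : IsEmbedding (U.domRestrict π) := (hOe x).isEmbedding.comp (.inclusion hU)
    have hPf := Cc.fiber_continuous (fiberSum_mem hπ.localHomeo h.mem_Cc) (π u)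
    have hmeas : AEStronglyMeasurable (fun y : Fiber (π u) => fiberSum π f y * k y)
        (((lamG.meas u).restrict {x | x.1 ∈ U}).map (hπ.hom.fiberMap u)) :=
      (hPf.measurable.mul hk).aestronglyMeasurable
    have hl : ∀ y : Fiber (π u), y ∉ {y : Fiber (π u) | y.1 ∈ π '' U} →
        fiberSum π f y * k y = 0 := fun y hy => by
      rw [fiberSum_eq_zero h0U hy, zero_mul]
    have hr : ∀ z : Fiber u, z ∉ {z : Fiber u | z.1 ∈ U} →
        f z * k (hπ.hom.fiberMap u z) = 0 := fun z hz => by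
      rw [h0U _ hz, zero_mul]
    -- Both integrands vanish off `π '' U` and `U` respectively, so the integrals reduce to the sets
    -- on which the intertwining hypothesis identifies the measures.
    rw [← setIntegral_eq_integral_of_forall_compl_eq_zero hl,
      ← setIntegral_eq_integral_of_forall_compl_eq_zero hr, ← hlam u hu U h.isOpen hemb,
      integral_map hm.aemeasurable hmeas]
    refine setIntegral_congr_fun (h.isOpen.preimage continuous_subtype_val).measurableSet ?_
    intro z hz
    change fiberSum π f (π z) * _ = _
    rw [fiberSum_apply_of_injOn hinj h0U hz]
  | zero => simp [fiberSum_zero]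
  | add f g hf hg h1 h2 =>
    have hf := hle hf
    have hg := hle hg
    rw [Cc.fiberSum_add hπ.localHomeo hf hg]
    simp only [Pi.add_apply, add_mul]
    rw [integral_add (fiber_integrable_mul (fiberSum_mem hπ.localHomeo hf) hk hC)
        (fiber_integrable_mul (fiberSum_mem hπ.localHomeo hg) hk hC), h1, h2,
      ← integral_add (fiber_integrable_mul (k := fun x => k (hπ.hom.fiberMap u x)) hf (hk.comp hm)
          fun _ => hC _)
        (fiber_integrable_mul (k := fun x => k (hπ.hom.fiberMap u x)) hg (hk.comp hm)
          fun _ => hC _)]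
  | smul c f _ h1 =>
    rw [fiberSum_smul]
    simp only [Pi.smul_apply, smul_eq_mul, mul_assoc]
    rw [integral_const_mul, integral_const_mul, h1]

/-- With $u$ the unit over $r(y)$, both sides equal $\int
f(z)\,\pi_*(g)(\pi(z)^{-1}y)\,d\lambda_G^u(z)$: the right side by the change of variables, the left
by summing $g(z^{-1}x)$ over $x\in\pi^{-1}(y)$ under the integral. -/
theorem fiberSum_conv (hπ : IsFiberwiseCovering π) (hlam : IntertwinesHaar hπ lamG lamH)
    {f g : G → ℂ} (hf : f ∈ Cc G) (hg : g ∈ Cc G) :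
    fiberSum π (conv lamG f g) = conv lamH (fiberSum π f) (fiberSum π g) := by
  classical
  funext y
  obtain ⟨u, hu, huy⟩ := hπ.exists_unit (r_mem y)
  have hru : ∀ x, π x = y → r x = u := fun x hx =>
    hπ.units_injOn (r_mem x) hu (by rw [hπ.hom.map_r, hx, huy])
  obtain ⟨K, hK, hK0⟩ := Cc.exists_compact hf
  obtain ⟨L, hL, hL0⟩ := Cc.exists_compact hg
  -- The points of the compact set $KL$ over `y`: one finite index set, independent of the
  -- integration variable, so that sum and integral can be interchanged.
  let T := (finite_fiber_inter hπ.localHomeo (isCompact_mul hK hL) y).toFinset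
  have hT : ∀ x, x ∈ T ↔ π x = y ∧
      x ∈ (fun p : G × G => mul p.1 p.2) '' (K ×ˢ L ∩ {p | d p.1 = r p.2}) := fun x => by
    simp only [T, Set.Finite.mem_toFinset, Set.mem_ofPred_eq]
  have hTr : ∀ x ∈ T, r x = u := fun x hx => hru x ((hT x).1 hx).1
  have hPg := fiberSum_mem hπ.localHomeo hg
  obtain ⟨C, hC⟩ := Cc.exists_bound hPg
  rw [conv_eq_of_r lamH huy.symm,
    integral_fiberSum_mul hπ hlam hu hf (continuous_div_left hPg huy.symm).measurable
      (fun _ => hC _),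
    fiberSum_eq_sum (T := T) (fun x hx => ((hT x).1 hx).1)
      (fun x h1 h2 => (hT x).2 ⟨h1, mem_mul_of_conv_ne_zero hK0 hL0 h2⟩),
    Finset.sum_congr rfl fun x hx => conv_eq_of_r lamG (hTr x hx),
    ← integral_finsetSum _ fun x hx => conv_integrable lamG hf hg (hTr x hx)]
  refine integral_congr_ae (Eventually.of_forall fun z => ?_)
  obtain ⟨z, rfl⟩ := z
  dsimp only [IsGroupoidHom.fiberMap]
  rw [← Finset.mul_sum]
  -- Only for `z ∈ K` is `T` large enough: a point `w ∈ L` of the fibre over $\pi(z)^{-1}y$ then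
  -- gives $zw\in KL$, hence $zw\in T$. Otherwise `f z = 0`.
  by_cases hz : z ∈ K
  swap
  · rw [hK0 z hz, zero_mul, zero_mul]
  congr 1
  have hzy : d (inv (π z)) = r y := by rw [d_inv, ← huy, hπ.hom.map_r]
  have hc : ∀ x ∈ T, d (inv z) = r x := fun x hx => by rw [d_inv, hTr x hx]
  rw [fiberSum_eq_sum (T := T.image fun x => mul (inv z) x), Finset.sum_image]
  · intro a ha b hb hab
    have := congrArg (mul z) hab
    dsimp only at this
    rwa [mul_inv_cancel_left _ _ (hTr a ha).symm, mul_inv_cancel_left _ _ (hTr b hb).symm] at this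
  · intro w hw
    obtain ⟨x, hx, rfl⟩ := Finset.mem_image.1 hw
    rw [hπ.hom.map_mul _ _ (hc x hx), hπ.hom.map_inv, ((hT x).1 hx).1]
  · intro w h1 h2
    have hwL : w ∈ L := by
      by_contra h; exact h2 (hL0 w h)
    -- The units `d z` and `r w` have the same image in `H`, so they coincide and the product `mul z
    -- w` is meaningful.
    have hcw : d z = r w := hπ.units_injOn (d_mem z) (r_mem w) (by
      rw [hπ.hom.map_d, hπ.hom.map_r, h1, r_mul _ _ hzy, r_inv])
    refine Finset.mem_image.2 ⟨mul z w, (hT _).2 ⟨?_, (z, w), ⟨⟨hz, hwL⟩, hcw⟩, rfl⟩,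
      inv_mul_cancel_left _ _ hcw⟩
    rw [hπ.hom.map_mul _ _ hcw, h1, mul_inv_cancel_left]
    rw [← hzy, d_inv]

/-- The change of variables cannot be applied directly to $|f|$, which need not lie in $C_c(G)$ when
$G$ is not Hausdorff. Instead $|\pi_*(f)|$ is written as $\pi_*(f)\,k$ with $|k|\le 1$. -/
theorem lintegral_fiberSum_le (hπ : IsFiberwiseCovering π) (hlam : IntertwinesHaar hπ lamG lamH)
    {f : G → ℂ} (hf : f ∈ Cc G) (v : H) :
    ∫⁻ y : Fiber v, ‖fiberSum π f y‖ₑ ∂lamH.meas v ≤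
      ⨆ u : G, ∫⁻ x : Fiber u, ‖f x‖ₑ ∂lamG.meas u := by
  by_cases hv : v ∈ units H
  swap
  · have : IsEmpty (Fiber v) := ⟨fun x => hv ⟨x.1, x.2⟩⟩
    simp
  obtain ⟨u, hu, rfl⟩ := hπ.exists_unit hv
  refine le_trans ?_ (le_iSup _ u)
  have hPf := fiberSum_mem hπ.localHomeo hf
  -- The conjugate phase, equal to 0 at zeros of the fibre sum by the convention for division by
  -- zero. It is in general only measurable, which is why the change of variables admits measurable
  -- `k`.
  let k : Fiber (π u) → ℂ := fun y => (starRingEnd ℂ) (fiberSum π f y) / (‖fiberSum π f y‖ : ℝ)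
  have hc := Cc.fiber_continuous hPf (π u)
  have hk : Measurable k :=
    (Complex.continuous_conj.comp hc).measurable.div
      (Complex.continuous_ofReal.comp hc.norm).measurable
  have hk1 : ∀ y, ‖k y‖ ≤ 1 := fun y => by
    simp only [k, norm_div, RCLike.norm_conj, Complex.norm_real, norm_norm]
    exact div_self_le_one _
  have hfk : ∀ y : Fiber (π u), fiberSum π f y * k y = ((‖fiberSum π f y‖ : ℝ) : ℂ) := fun y => by
    simp only [k]
    rw [← mul_div_assoc, Complex.mul_conj']
    by_cases h : ‖fiberSum π f y‖ = 0
    · simp [h]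
    · have h' : ((‖fiberSum π f y‖ : ℝ) : ℂ) ≠ 0 := by exact_mod_cast h
      field_simp
  have key := integral_fiberSum_mul hπ hlam hu hf hk hk1
  simp only [hfk] at key
  rw [integral_complex_ofReal] at key
  rw [← ofReal_integral_norm_eq_lintegral_enorm (fiber_integrable lamH hPf (π u)),
    ← Real.enorm_of_nonneg (integral_nonneg fun y => norm_nonneg _)]
  have e : ‖∫ y : Fiber (π u), ‖fiberSum π f y‖ ∂lamH.meas (π u)‖ₑ =
      ‖((∫ y : Fiber (π u), ‖fiberSum π f y‖ ∂lamH.meas (π u) : ℝ) : ℂ)‖ₑ := by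
    rw [← ofReal_norm, ← ofReal_norm, Complex.norm_real]
  rw [e, key]
  refine (enorm_integral_le_lintegral_enorm _).trans (lintegral_mono fun x => ?_)
  rw [enorm_mul]
  have h1 : ‖k (hπ.hom.fiberMap u x)‖ₑ ≤ 1 := by
    rw [← ofReal_norm, ← ENNReal.ofReal_one]
    exact ENNReal.ofReal_le_ofReal (hk1 _)
  simpa using mul_le_mul_right h1 ‖f x‖ₑ

/-- The second supremum in the $I$-norm of $f$ is the first one for $f^*$, and $\pi_*$ commutes with
the involution. -/
theorem iNorm_fiberSum_le (hπ : IsFiberwiseCovering π) (hlam : IntertwinesHaar hπ lamG lamH)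
    {f : G → ℂ} (hf : f ∈ Cc G) : iNorm lamH (fiberSum π f) ≤ iNorm lamG f := by
  refine max_le_max (iSup_le fun v => lintegral_fiberSum_le hπ hlam hf v) (iSup_le fun v => ?_)
  have h := lintegral_fiberSum_le hπ hlam (invol_mem hf) v
  rw [fiberSum_invol hπ hf] at h
  simpa [invol] using h

/-- The `*`-homomorphism `π_* : C_c(G) → C_c(H)`. -/
noncomputable def pushforward (hπ : IsFiberwiseCovering π) (hlam : IntertwinesHaar hπ lamG lamH) :
    ConvAlg lamG →⋆ₙₐ[ℂ] ConvAlg lamH where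
  toFun f := ⟨fiberSum π f, fiberSum_mem hπ.localHomeo f.mem⟩
  map_smul' c f := Subtype.ext (fiberSum_smul c f.1)
  map_zero' := Subtype.ext fiberSum_zero
  map_add' f g := Subtype.ext (Cc.fiberSum_add hπ.localHomeo f.mem g.mem)
  map_mul' f g := Subtype.ext (fiberSum_conv hπ hlam f.mem g.mem)
  map_star' f := Subtype.ext (fiberSum_invol hπ f.mem)

theorem pushforward_surjective (hπ : IsFiberwiseCovering π)
    (hlam : IntertwinesHaar hπ lamG lamH) : Function.Surjective (pushforward hπ hlam) := by
  intro g
  obtain ⟨f, hf, hfg⟩ := exists_fiberSum_eq hπ.localHomeo hπ.surjective g.mem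
  exact ⟨(⟨f, hf⟩ : Cc G), Subtype.ext hfg⟩

end CoveringAlgebra

/-! ### Functoriality of the $C^*$-envelope -/

section Envelope

variable {G : Type u} {H : Type v} [TopologicalSpace G] [TopGroupoid G] [LCGroupoid G]
  [MeasurableSpace G] [BorelSpace G] [TopologicalSpace H] [TopGroupoid H] [LCGroupoid H]
  [MeasurableSpace H] [BorelSpace H] {lamG : HaarSystem G} {lamH : HaarSystem H}
  (P : ConvAlg lamG →⋆ₙₐ[ℂ] ConvAlg lamH) (hP : ∀ f, iNorm lamH (P f) ≤ iNorm lamG f)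

/-- The pullback of a representation along an `I`-norm decreasing `*`-homomorphism. -/
noncomputable def Rep.comap (σ : Rep.{v, w} lamH) : Rep.{u, w} lamG where
  -- The Hilbert space is unchanged, so both envelopes must use representations on spaces in the
  -- same universe `w`.
  space := σ.space
  hom := σ.hom.comp P
  bound f := (σ.bound (P f)).trans (hP f)

/-- The `*`-homomorphism of products of representations induced by pulling back representations. -/
noncomputable def RepProd.map : RepProd.{u, w} lamG →⋆ₙₐ[ℂ] RepProd.{v, w} lamH where
  -- Reindexing along pullback selects some of the components of `a`, so the supremum of their norms
  -- is at most `‖a‖`.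
  toFun a := ⟨fun σ => a.1 (σ.comap P hP), by
    refine memℓp_infty ⟨‖a‖, ?_⟩
    rintro _ ⟨σ, rfl⟩
    exact lp.norm_apply_le_norm ENNReal.top_ne_zero a (σ.comap P hP)⟩
  map_smul' _ _ := rfl
  map_zero' := rfl
  map_add' _ _ := rfl
  map_mul' _ _ := rfl
  map_star' _ := rfl

theorem RepProd.map_universalRep (f : ConvAlg lamG) :
    RepProd.map P hP (universalRep.{u, w} lamG f) = universalRep.{v, w} lamH (P f) := rfl

/-- A $*$-homomorphism of $C^*$-algebras is contractive, hence maps the closure of the image of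
$C_c(G)$ into the closure of the image of $C_c(H)$. -/
theorem RepProd.map_mem (a : MaxCStar.{u, w} lamG) : RepProd.map P hP a.1 ∈
    (NonUnitalStarAlgHom.range (universalRep.{v, w} lamH)).topologicalClosure := by
  have hc : Continuous (RepProd.map.{u, v, w} P hP) :=
    AddMonoidHomClass.continuous_of_bound _ 1 fun a => by
      rw [one_mul]; exact NonUnitalStarAlgHom.norm_apply_le _ a
  refine map_mem_closure hc a.2 ?_
  rintro _ ⟨f, rfl⟩
  exact ⟨P f, (RepProd.map_universalRep P hP f).symm⟩

/-- The `*`-homomorphism of `C*`-envelopes induced by an `I`-norm decreasing `*`-homomorphism. -/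
noncomputable def MaxCStar.map : MaxCStar.{u, w} lamG →⋆ₙₐ[ℂ] MaxCStar.{v, w} lamH where
  toFun a := ⟨RepProd.map P hP a.1, RepProd.map_mem P hP a⟩
  map_smul' _ _ := rfl
  map_zero' := rfl
  map_add' _ _ := rfl
  map_mul' _ _ := rfl
  map_star' _ := rfl

theorem MaxCStar.map_ofCc (f : ConvAlg lamG) :
    MaxCStar.map P hP (MaxCStar.ofCc.{u, w} lamG f) = MaxCStar.ofCc.{v, w} lamH (P f) := rfl

/-- The range contains the canonical image of $C_c(H)$, because `P` is onto, and that image is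
dense. -/
theorem MaxCStar.map_surjective (hs : Function.Surjective P) :
    Function.Surjective (MaxCStar.map.{u, v, w} P hP) := by
  refine surjective_of_denseRange _ ((MaxCStar.denseRange_ofCc.{v, w} lamH).mono ?_)
  rintro _ ⟨g, rfl⟩
  obtain ⟨f, rfl⟩ := hs g
  exact ⟨_, MaxCStar.map_ofCc P hP f⟩

end Envelope

end FiberwiseCovering

/-! ### The main theorem -/

theorem mainTheorem6 {G : Type u} {H : Type v}
    [TopologicalSpace G] [FiberwiseCovering.TopGroupoid G] [FiberwiseCovering.LCGroupoid G]
    [MeasurableSpace G] [BorelSpace G]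
    [TopologicalSpace H] [FiberwiseCovering.TopGroupoid H] [FiberwiseCovering.LCGroupoid H]
    [MeasurableSpace H] [BorelSpace H]
    (lamG : FiberwiseCovering.HaarSystem G) (lamH : FiberwiseCovering.HaarSystem H)
    (π : G → H) (hπ : FiberwiseCovering.IsFiberwiseCovering π)
    (hlam : FiberwiseCovering.IntertwinesHaar hπ lamG lamH) :
    (∀ f ∈ FiberwiseCovering.Cc G, ∀ y : H, {x | π x = y ∧ f x ≠ 0}.Finite) ∧
    ∃ P : FiberwiseCovering.ConvAlg lamG →⋆ₙₐ[ℂ] FiberwiseCovering.ConvAlg lamH,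
      (∀ (f : FiberwiseCovering.ConvAlg lamG) (y : H),
        (P f) y = FiberwiseCovering.fiberSum π f y) ∧
      Function.Surjective P ∧
      ∃ Φ : FiberwiseCovering.MaxCStar.{u, w} lamG →⋆ₙₐ[ℂ] FiberwiseCovering.MaxCStar.{v, w} lamH,
        (∀ f : FiberwiseCovering.ConvAlg lamG,
          Φ (FiberwiseCovering.MaxCStar.ofCc lamG f) =
            FiberwiseCovering.MaxCStar.ofCc lamH (P f)) ∧
        Function.Surjective Φ := by
  refine ⟨fun f hf y => FiberwiseCovering.Cc.finite_fiber hπ.localHomeo hf y,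
    FiberwiseCovering.pushforward hπ hlam, fun _ _ => rfl,
    FiberwiseCovering.pushforward_surjective hπ hlam,
    FiberwiseCovering.MaxCStar.map (FiberwiseCovering.pushforward hπ hlam)
      fun f => FiberwiseCovering.iNorm_fiberSum_le hπ hlam f.mem,
    fun f => FiberwiseCovering.MaxCStar.map_ofCc _ _ f,
    FiberwiseCovering.MaxCStar.map_surjective _ _
      (FiberwiseCovering.pushforward_surjective hπ hlam)⟩
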